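/- Conventions. Link diagrams lie in $\mathbb R^2$ and may be disconnected. Colour the regions of $\mathbb R^2\setminus L$ black and white like a checkerboard, the unbounded region being white. A crossing $p$ has $\eta(p)=+1$ if the overcrossing strand, rotated counterclockwise about $p$, sweeps the two black corners at $p$, and $\eta(p)=-1$ otherwise. Let $X_0,\dots,X_m$ be the white regions, with $X_0$ the unbounded one, and let $G'(L)=(g_{ij})_{0\le i,j\le m}$, where for $i\ne j$, $g_{ij}=-\sum_p\eta(p)$, the sum being over the crossings at which $X_i$ and $X_j$ meet as opposite corners, and $g_{ii}=-\sum_{k\ne i}g_{ik}$. The Goeritz matrix $G(L)$ is $G'(L)$ with the row and column of $X_0$ removed (the empty matrix has determinant $1$, and signature and rank $0$); $\sigma(G)$ is the signature of the symmetric matrix $G$. If $L$ is oriented, a crossing is of type II if the orientation of the strands is not coherent along the boundary of the black corners at it, i.e. the two half-edges bounding a black corner both point towards or both point away from the crossing. Put $\mu(L)=\sum\eta(p)$ over the crossings of type II, and $\sigma(L)=\sigma(G(L))-\mu(L)$, the signature of the link $L$. Let $L_0$, $L_n$ ($n\in\mathbb Z$) and $L_\infty$ be diagrams that agree outside a disk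 $\Delta$ whose boundary they meet in the same four points NE, NW, SW, SE. In $\Delta$, $L_0$ consists of two horizontal arcs (NW–NE and SW–SE), $L_\infty$ of two vertical arcs (NW–SW and NE–SE), and $L_n$, $n\neq0$, of a horizontal row of $|n|$ crossings (two strands twisted about each other by $|n|$ half-twists); at each crossing the strand from northwest to southeast is on top if $n>0$, and the strand from northeast to southwest is on top if $n<0$. Theorem. (A) Assume that the regions of $\mathbb R^2\setminus L_0$ which touch $\Delta$ from the north and from the south are white. (i) If these are two different regions (so that they are obtained by dividing one white region of $\mathbb R^2\setminus L_\infty$), then for all $n\in\mathbb Z$ $$\det G(L_n)-\det G(L_0)=n\det G(L_\infty).$$ (ii) For all $n\ge0$, $\ \sigma(G(L_0))\le\sigma(G(L_n))\le\sigma(G(L_0))+2$. (iii) For all $n\in\mathbb Z$, $\ |\sigma(G(L_n))-\sigma(G(L_\infty))|\le1$. Moreover $\sigma(G(L_n))=\sigma(G(L_\infty))$ if and only if $\operatorname{rank}G(L_n)=\operatorname{rank}G(L_\infty)$ or $\operatorname{rank}G(L_n)=\operatorname{rank}G(L_\infty)+2$. (B) Let the colour of the northern and southern regions be arbitrary. (i)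 ($t_n$-moves.) Let $n\ge0$, and let $L_0$ and $L_n$ be oriented so that the orientations agree outside $\Delta$ and the two strings of $L_0$ in $\Delta$ are parallel. Then $n-2\le\sigma(L_0)-\sigma(L_n)\le n$. (ii) ($\bar t_{2k}$-moves.) Let $k\ge0$, and let $L_0$ and $L_{2k}$ be oriented so that the orientations agree outside $\Delta$ and the two strings of $L_0$ in $\Delta$ are anti-parallel. Then $0\le\sigma(L_{2k})-\sigma(L_0)\le2$. (iii) If $L_+$ and $L_-$ are oriented diagrams which are identical except at one crossing, positive in $L_+$ and negative in $L_-$, then $0\le\sigma(L_-)-\sigma(L_+)\le2$. -/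

import Mathlib

open Matrix

/-- The darts (half-edges) of a 4-valent picture: four at every crossing, two at every marked
point of a strand. -/
abbrev LinkDart (C P : Type) : Type := (C × Fin 4) ⊕ (P × Fin 2)

namespace LinkDart

variable {C P : Type}

/-- The next dart, counterclockwise, around the same vertex. -/
def rot : LinkDart C P → LinkDart C P
  | Sum.inl (c, i) => Sum.inl (c, i + 1)
  | Sum.inr (p, i) => Sum.inr (p, i + 1)

/-- The previous dart around the same vertex, i.e. the next one clockwise. -/
def unrot : LinkDart C P → LinkDart C P
  | Sum.inl (c, i) => Sum.inl (c, i - 1)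
  | Sum.inr (p, i) => Sum.inr (p, i - 1)

end LinkDart

open LinkDart

/-- An unoriented link diagram in the plane together with its checkerboard colouring, as a
combinatorial map. The diagram need not be connected.

The vertices are the crossings, with darts `0, 1, 2, 3` in counterclockwise order (so that `0, 2`
and `1, 3` lie on the two strands), and auxiliary marked points on the strands, with darts `0, 1`.
Marked points are ignored by everything below; they let a component without
crossings (a circle with at least one marked point) be described by darts as well.

`region d` is the component of the complement of the diagram that contains the corner between
the dart `d` and the next dart `rot d` counterclockwise; travelling outwards along `d` it is the
region on the left, while the region on the right is `region (unrot d)`. -/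
structure LinkDiagram where
  /-- the crossings -/
  Crossing : Type
  /-- the marked points on the strands -/
  Point : Type
  /-- the regions, i.e. the components of the complement of the diagram -/
  Region : Type
  [fintypeCrossing : Fintype Crossing]
  [fintypePoint : Fintype Point]
  [fintypeRegion : Fintype Region]
  [decEqCrossing : DecidableEq Crossing]
  [decEqPoint : DecidableEq Point]
  [decEqRegion : DecidableEq Region]
  /-- the other half of the edge of a dart -/
  edge : LinkDart Crossing Point → LinkDart Crossing Point
  edge_edge : ∀ d, edge (edge d) = d
  edge_ne : ∀ d, edge d ≠ d
  /-- `true` if the strand through the darts `0, 2` is the overcrossing one, `false` if it is the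
  strand through the darts `1, 3` -/
  overEven : Crossing → Bool
  /-- the region at the corner between `d` and `rot d` -/
  region : LinkDart Crossing Point → Region
  /-- the two ends of an edge see the same region on the same side -/
  region_face : ∀ d, region (unrot (edge d)) = region d
  /-- The surface is connected: a function on the regions which takes equal values on the two
  sides of every edge is constant. -/
  connected : ∀ c : Region → ZMod 2,
    (∀ d, c (region d) = c (region (unrot d))) → ∀ r s, c r = c s
  /-- Planarity (the surface is a sphere), in the form of the Jordan curve theorem: every mod 2
  cycle `f` of edges of the diagram is the boundary of a set `c` of regions. As `connected` says
  that the kernel of the boundary map on sets of regions has dimension one, and the cycles have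
  dimension `E - V + K` (`K` the number of connected components of the diagram), this is the
  same as Euler's formula `V - E + R = 1 + K`. -/
  jordan : ∀ f : LinkDart Crossing Point → ZMod 2, (∀ d, f (edge d) = f d) →
    (∀ x, ∑ i : Fin 4, f (Sum.inl (x, i)) = 0) →
    (∀ p, ∑ i : Fin 2, f (Sum.inr (p, i)) = 0) →
    ∃ c : Region → ZMod 2, ∀ d, f d = c (region d) + c (region (unrot d))
  /-- the unbounded region -/
  base : Region
  /-- the checkerboard colouring: `true` is white, `false` is black -/
  white : Region → Bool
  /-- regions on the two sides of an edge have different colours -/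
  white_ne : ∀ d, white (region d) ≠ white (region (unrot d))
  /-- the unbounded region is white -/
  white_base : white base = true

namespace LinkDiagram

attribute [instance] fintypeCrossing fintypePoint fintypeRegion
attribute [instance] decEqCrossing decEqPoint decEqRegion

/-- The darts of a diagram. -/
abbrev Dart (D : LinkDiagram) : Type := LinkDart D.Crossing D.Point

/-- The region at the corner of the crossing `x` between its darts `i` and `i + 1`. -/
abbrev corner (D : LinkDiagram) (x : D.Crossing) (i : Fin 4) : D.Region :=
  D.region (Sum.inl (x, i))

/-! ### Goeritz matrices and signatures -/

/-- The white regions. -/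
abbrev WhiteRegion (D : LinkDiagram) : Type := {r : D.Region // D.white r = true}

/-- The unbounded region, as a white region. -/
def baseWhite (D : LinkDiagram) : D.WhiteRegion := ⟨D.base, D.white_base⟩

/-- The sign `η` of a crossing, which does not depend on orientations: it is `+1` if the strand
on top, when turned counterclockwise around the crossing, sweeps the black corners, and `-1` if it
sweeps the white ones. (If the darts `0, 2` are on top these are the corners `0` and `2`; if the
darts `1, 3` are on top, the corners `1` and `3`, whose colour is the other one.) -/
def eta (D : LinkDiagram) (x : D.Crossing) : ℤ :=
  if D.overEven x = !D.white (D.corner x 0) then 1 else -1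

/-- The crossing `x` connects the regions `r` and `s`: they lie at opposite corners of `x`. -/
def Connects (D : LinkDiagram) (x : D.Crossing) (r s : D.Region) : Prop :=
  ∃ k : Fin 4, D.corner x k = r ∧ D.corner x (k + 2) = s

instance (D : LinkDiagram) (x : D.Crossing) (r s : D.Region) : Decidable (D.Connects x r s) :=
  inferInstanceAs (Decidable (∃ k : Fin 4, D.corner x k = r ∧ D.corner x (k + 2) = s))

/-- The off-diagonal entries of the unreduced Goeritz matrix. -/
def goeritzEntry (D : LinkDiagram) (r s : D.WhiteRegion) : ℤ :=
  -∑ x with D.Connects x r.1 s.1, D.eta x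

/-- The unreduced Goeritz matrix, indexed by all white regions. -/
def unreducedGoeritz (D : LinkDiagram) : Matrix D.WhiteRegion D.WhiteRegion ℤ :=
  Matrix.of fun r s =>
    if r = s then -∑ t with t ≠ r, D.goeritzEntry r t else D.goeritzEntry r s

/-- The (reduced) Goeritz matrix: the row and the column of the unbounded region are removed. -/
def goeritz (D : LinkDiagram) :
    Matrix {r : D.WhiteRegion // r ≠ D.baseWhite} {r : D.WhiteRegion // r ≠ D.baseWhite} ℤ :=
  D.unreducedGoeritz.submatrix Subtype.val Subtype.val

/-- The Goeritz matrix with real entries. -/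
noncomputable def realGoeritz (D : LinkDiagram) :
    Matrix {r : D.WhiteRegion // r ≠ D.baseWhite} {r : D.WhiteRegion // r ≠ D.baseWhite} ℝ :=
  D.goeritz.map (fun z : ℤ => (z : ℝ))

/-- The signature `σ(G)` of the Goeritz matrix. -/
noncomputable def goeritzSignature (D : LinkDiagram) : ℤ :=
  (sigPos D.realGoeritz.toQuadraticForm' : ℤ) - (sigNeg D.realGoeritz.toQuadraticForm' : ℤ)

/-- The rank of the Goeritz matrix. -/
noncomputable def goeritzRank (D : LinkDiagram) : ℕ := D.realGoeritz.rank

/-- An orientation of the link: `out d` tells whether the strand runs along the dart `d` away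
from its vertex. -/
structure Orientation (D : LinkDiagram) where
  out : D.Dart → Bool
  out_edge : ∀ d, out (D.edge d) = !out d
  out_crossing : ∀ x i, out (Sum.inl (x, i + 2)) = !out (Sum.inl (x, i))
  out_point : ∀ p i, out (Sum.inr (p, i + 1)) = !out (Sum.inr (p, i))

namespace Orientation

variable {D : LinkDiagram}

/-- A crossing is of type II if the two darts that bound a black corner both run away
from the crossing or both run towards it; otherwise, if the orientation is coherent along the
boundary of each black corner, it is of type I. -/
def IsTypeII (o : Orientation D) (x : D.Crossing) : Prop :=
  ∀ k : Fin 4, D.white (D.corner x k) = false →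
    o.out (Sum.inl (x, k)) = o.out (Sum.inl (x, k + 1))

instance (o : Orientation D) (x : D.Crossing) : Decidable (o.IsTypeII x) :=
  inferInstanceAs (Decidable (∀ k : Fin 4, D.white (D.corner x k) = false →
    o.out (Sum.inl (x, k)) = o.out (Sum.inl (x, k + 1))))

/-- The correction term `μ`: the sum of `η` over the crossings of type II. -/
def mu (o : Orientation D) : ℤ := ∑ x with o.IsTypeII x, D.eta x

/-- The signature `σ(L) = σ(G(L)) - μ(L)` of the oriented link given by the diagram. -/
noncomputable def signature (o : Orientation D) : ℤ := D.goeritzSignature - o.mu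

/-- The crossing `x` is positive: the outgoing dart of the lower strand comes right after the
outgoing dart of the upper strand in counterclockwise order. -/
def IsPositive (o : Orientation D) (x : D.Crossing) : Prop :=
  ∃ k : Fin 4, D.overEven x = decide (k = 0 ∨ k = 2) ∧
    o.out (Sum.inl (x, k)) = true ∧ o.out (Sum.inl (x, k + 1)) = true

end Orientation

/-! ### Changing a crossing -/

/-- The diagram in which the crossing `v` has been changed: its upper strand becomes the lower
one. -/
def crossingChange (D : LinkDiagram) (v : D.Crossing) : LinkDiagram :=
  { D with overEven := fun x => if x = v then !D.overEven x else D.overEven x }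

/-- The orientation inherited by the diagram with a changed crossing. -/
def Orientation.crossingChange {D : LinkDiagram} (o : Orientation D) (v : D.Crossing) :
    Orientation (D.crossingChange v) where
  out := o.out
  out_edge := o.out_edge
  out_crossing := o.out_crossing
  out_point := o.out_point

/-! ### Smoothing a crossing -/

/-- The map which renames `b` into `a`. -/
def identify {R : Type} [DecidableEq R] (a b : R) (r : R) : R := if r = b then a else r

section smooth

variable (D : LinkDiagram) (v : D.Crossing) (s : Fin 4)

/-- When the vertex `v` is replaced by two arcs, one joining its darts `s, s + 1` and the other
one joining `s + 2, s + 3`, the darts stay the same. The arcs carry marked points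
`Sum.inr 0` and `Sum.inr 1`. -/
def smoothToOld : LinkDart {x : D.Crossing // x ≠ v} (D.Point ⊕ Fin 2) → D.Dart
  | Sum.inl (x, i) => Sum.inl (x.1, i)
  | Sum.inr (Sum.inl p, i) => Sum.inr (p, i)
  | Sum.inr (Sum.inr j, i) => Sum.inl (v, s + Fin.ofNat 4 (2 * j.val + i.val))

/-- The inverse of `smoothToOld`. -/
def smoothOfOld : D.Dart → LinkDart {x : D.Crossing // x ≠ v} (D.Point ⊕ Fin 2)
  | Sum.inl (x, i) =>
      if h : x = v then
        Sum.inr (Sum.inr (Fin.ofNat 2 ((i - s).val / 2)), Fin.ofNat 2 (i - s).val)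
      else Sum.inl (⟨x, h⟩, i)
  | Sum.inr (p, i) => Sum.inr (Sum.inl p, i)

theorem smoothToOld_ofOld (d : D.Dart) : D.smoothToOld v s (D.smoothOfOld v s d) = d := by
  rcases d with ⟨x, i⟩ | ⟨p, i⟩
  · by_cases h : x = v
    · subst h
      simp only [smoothOfOld, dite_true, smoothToOld]
      congr 2
      revert s i; decide
    · simp [smoothOfOld, h, smoothToOld]
  · rfl

theorem smoothOfOld_toOld (d) : D.smoothOfOld v s (D.smoothToOld v s d) = d := by
  rcases d with ⟨x, i⟩ | ⟨p | j, i⟩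
  · simp [smoothOfOld, x.2, smoothToOld]
  · rfl
  · simp only [smoothOfOld, dite_true, smoothToOld]
    congr 2
    · congr 1
      revert s i j; decide
    · revert s i j; decide

theorem smooth_white (i : Fin 4) : D.white (D.corner v (i + 2)) = D.white (D.corner v i) := by
  have h1 := D.white_ne (Sum.inl (v, i + 1))
  have h2 := D.white_ne (Sum.inl (v, i + 2))
  have e1 : ∀ i : Fin 4, i + 1 - 1 = i := by decide
  have e2 : ∀ i : Fin 4, i + 2 - 1 = i + 1 := by decide
  simp only [unrot, e1, e2] at h1 h2
  simp only [corner]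
  revert h1 h2
  generalize D.white _ = a
  generalize D.white _ = b
  generalize D.white _ = c
  revert a b c; decide

/-- After the smoothing, the corners `s + 1` and `s + 3` at `v` belong to one region. -/
def smoothMerge : D.Region → D.Region :=
  identify (D.corner v (s + 1)) (D.corner v (s + 3))

theorem smooth_white_corners :
    D.white (D.corner v (s + 1)) = D.white (D.corner v (s + 3)) := by
  have e : ∀ s : Fin 4, s + 3 = s + 1 + 2 := by decide
  rw [e, D.smooth_white]

theorem smoothMerge_corner :
    D.smoothMerge v s (D.corner v (s + 3)) = D.smoothMerge v s (D.corner v (s + 1)) := by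
  simp [smoothMerge, identify]

theorem smoothMerge_comp {α : Type} (c : D.Region → α)
    (h : c (D.corner v (s + 1)) = c (D.corner v (s + 3))) (r : D.Region) :
    c (D.smoothMerge v s r) = c r := by
  unfold smoothMerge identify
  split_ifs with hr
  · rw [hr, h]
  · rfl

theorem smoothMerge_unrot (d) :
    D.smoothMerge v s (D.region (D.smoothToOld v s (unrot d))) =
      D.smoothMerge v s (D.region (unrot (D.smoothToOld v s d))) := by
  rcases d with ⟨x, i⟩ | ⟨p | j, i⟩
  · rfl
  · rfl
  · have h := D.smoothMerge_corner v s
    have e0 : ∀ s : Fin 4, s + 0 - 1 = s + 3 := by decide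
    have e1 : ∀ s : Fin 4, s + 1 - 1 = s + 0 := by decide
    have e2 : ∀ s : Fin 4, s + 2 - 1 = s + 1 := by decide
    have e3 : ∀ s : Fin 4, s + 3 - 1 = s + 2 := by decide
    fin_cases j <;> fin_cases i
    · change D.smoothMerge v s (D.corner v (s + 1)) = D.smoothMerge v s (D.corner v (s + 0 - 1))
      rw [e0, h]
    · change D.smoothMerge v s (D.corner v (s + 0)) = D.smoothMerge v s (D.corner v (s + 1 - 1))
      rw [e1]
    · change D.smoothMerge v s (D.corner v (s + 3)) = D.smoothMerge v s (D.corner v (s + 2 - 1))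
      rw [e2, h]
    · change D.smoothMerge v s (D.corner v (s + 2)) = D.smoothMerge v s (D.corner v (s + 3 - 1))
      rw [e3]

theorem smooth_sum (f : LinkDart {x : D.Crossing // x ≠ v} (D.Point ⊕ Fin 2) → ZMod 2) :
    ∑ i : Fin 4, f (D.smoothOfOld v s (Sum.inl (v, i))) =
      (f (Sum.inr (Sum.inr 0, 0)) + f (Sum.inr (Sum.inr 0, 1))) +
        (f (Sum.inr (Sum.inr 1, 0)) + f (Sum.inr (Sum.inr 1, 1))) := by
  rw [← Equiv.sum_comp (Equiv.addLeft s), Fin.sum_univ_four]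
  have h := fun j i => D.smoothOfOld_toOld v s (Sum.inr (Sum.inr j, i))
  have h00 := h 0 0
  have h01 := h 0 1
  have h10 := h 1 0
  have h11 := h 1 1
  simp only [smoothToOld] at h00 h01 h10 h11
  rw [← h00, ← h01, ← h10, ← h11, ← add_assoc]
  rfl

/-- The diagram obtained from `D` by replacing the vertex `v` with two arcs, one joining its
darts `s, s + 1` and the other one joining its darts `s + 2, s + 3`. The corners `s + 1` and
`s + 3` are then in the same region, and the regions are otherwise unchanged. -/
def smooth : LinkDiagram where
  Crossing := {x : D.Crossing // x ≠ v}
  Point := D.Point ⊕ Fin 2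
  Region := Set.range (D.smoothMerge v s)
  edge d := D.smoothOfOld v s (D.edge (D.smoothToOld v s d))
  edge_edge d := by
    rw [smoothToOld_ofOld, D.edge_edge, smoothOfOld_toOld]
  edge_ne d h := by
    have := congrArg (D.smoothToOld v s) h
    rw [smoothToOld_ofOld] at this
    exact D.edge_ne _ this
  overEven x := D.overEven x.1
  region d := ⟨D.smoothMerge v s (D.region (D.smoothToOld v s d)), Set.mem_range_self _⟩
  region_face d := by
    apply Subtype.ext
    change D.smoothMerge v s _ = D.smoothMerge v s _
    rw [smoothMerge_unrot, smoothToOld_ofOld, D.region_face]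
  connected c hc := by
    have key := D.connected (fun r => c ⟨D.smoothMerge v s r, Set.mem_range_self _⟩) (by
      intro d
      have h := hc (D.smoothOfOld v s d)
      simp only [smoothMerge_unrot, smoothToOld_ofOld] at h
      exact h)
    rintro ⟨_, r, rfl⟩ ⟨_, t, rfl⟩
    exact key r t
  jordan f hf hx hp := by
    obtain ⟨c, hc⟩ := D.jordan (fun d => f (D.smoothOfOld v s d))
      (by
        intro d
        have h := hf (D.smoothOfOld v s d)
        rwa [smoothToOld_ofOld] at h)
      (by
        intro x
        by_cases h : x = v
        · subst h
          have h0 := hp (Sum.inr 0)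
          have h1 := hp (Sum.inr 1)
          rw [Fin.sum_univ_two] at h0 h1
          rw [smooth_sum, h0, h1, add_zero]
        · have := hx ⟨x, h⟩
          simpa [smoothOfOld, h] using this)
      (by
        intro p
        exact hp (Sum.inl p))
    have hv : c (D.corner v (s + 1)) = c (D.corner v (s + 3)) := by
      have h0 := hp (Sum.inr 0)
      rw [Fin.sum_univ_two, ← D.smoothOfOld_toOld v s (Sum.inr (Sum.inr 0, 0)),
        ← D.smoothOfOld_toOld v s (Sum.inr (Sum.inr 0, 1)), hc, hc] at h0
      have e0 : ∀ s : Fin 4, s + 0 - 1 = s + 3 := by decide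
      have e1 : ∀ s : Fin 4, s + 1 - 1 = s + 0 := by decide
      change c (D.corner v (s + 0)) + c (D.corner v (s + 0 - 1)) +
        (c (D.corner v (s + 1)) + c (D.corner v (s + 1 - 1))) = 0 at h0
      rw [e0, e1] at h0
      revert h0
      generalize c _ = x
      generalize c _ = y
      generalize c _ = z
      revert x y z; decide
    refine ⟨fun r => c r.1, fun d => ?_⟩
    have h := hc (D.smoothToOld v s d)
    rw [smoothOfOld_toOld] at h
    simp only [smoothMerge_unrot]
    rw [h, D.smoothMerge_comp v s c hv, D.smoothMerge_comp v s c hv]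
  base := ⟨D.smoothMerge v s D.base, Set.mem_range_self _⟩
  white r := D.white r.1
  white_ne d := by
    have hv := D.smooth_white_corners v s
    have h := D.white_ne (D.smoothToOld v s d)
    simp only [smoothMerge_unrot]
    rwa [D.smoothMerge_comp v s D.white hv, D.smoothMerge_comp v s D.white hv]
  white_base := by
    have hv := D.smooth_white_corners v s
    change D.white (D.smoothMerge v s D.base) = true
    rw [D.smoothMerge_comp v s D.white hv, D.white_base]

end smooth

/-! ### Replacing a crossing by a row of crossings -/

section twist

variable (D : LinkDiagram) (v : D.Crossing) (m : ℕ)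

/-- The vertex `v` is replaced by a horizontal row of crossings `0, ..., m`, with `0` on the left
(west). At `v` and at each crossing of the row the darts `0, 1, 2, 3` point to the northeast, the
northwest, the southwest and the southeast. The darts of `v` become the western darts of the
crossing `0` and the eastern darts of the crossing `m`; the other darts of `D` are kept. -/
def twistOfOld : D.Dart → LinkDart ({x : D.Crossing // x ≠ v} ⊕ Fin (m + 1)) D.Point
  | Sum.inl (x, i) =>
      if h : x = v then
        Sum.inl (Sum.inr (if i = 0 ∨ i = 3 then Fin.last m else 0), i)
      else Sum.inl (Sum.inl ⟨x, h⟩, i)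
  | Sum.inr (p, i) => Sum.inr (p, i)

/-- The edges: old edges are kept, and the eastern darts `0, 3` of the crossing `k` of the row are
joined to the western darts `1, 2` of the crossing `k + 1`. -/
def twistEdge : LinkDart ({x : D.Crossing // x ≠ v} ⊕ Fin (m + 1)) D.Point →
    LinkDart ({x : D.Crossing // x ≠ v} ⊕ Fin (m + 1)) D.Point
  | Sum.inl (Sum.inl x, i) => D.twistOfOld v m (D.edge (Sum.inl (x.1, i)))
  | Sum.inl (Sum.inr k, 0) =>
      if h : k.val < m then Sum.inl (Sum.inr ⟨k.val + 1, by omega⟩, 1)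
      else D.twistOfOld v m (D.edge (Sum.inl (v, 0)))
  | Sum.inl (Sum.inr k, 1) =>
      if k.val = 0 then D.twistOfOld v m (D.edge (Sum.inl (v, 1)))
      else Sum.inl (Sum.inr ⟨k.val - 1, by omega⟩, 0)
  | Sum.inl (Sum.inr k, 2) =>
      if k.val = 0 then D.twistOfOld v m (D.edge (Sum.inl (v, 2)))
      else Sum.inl (Sum.inr ⟨k.val - 1, by omega⟩, 3)
  | Sum.inl (Sum.inr k, 3) =>
      if h : k.val < m then Sum.inl (Sum.inr ⟨k.val + 1, by omega⟩, 2)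
      else D.twistOfOld v m (D.edge (Sum.inl (v, 3)))
  | Sum.inr (p, i) => D.twistOfOld v m (D.edge (Sum.inr (p, i)))

/-- The regions: those of `D`, and for each `j < m` the bigon between the crossings `j` and
`j + 1` of the row. All crossings of the row have the northern and southern region of `v` as
northern and southern region. -/
def twistRegion : LinkDart ({x : D.Crossing // x ≠ v} ⊕ Fin (m + 1)) D.Point →
    D.Region ⊕ Fin m
  | Sum.inl (Sum.inl x, i) => Sum.inl (D.region (Sum.inl (x.1, i)))
  | Sum.inl (Sum.inr _, 0) => Sum.inl (D.corner v 0)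
  | Sum.inl (Sum.inr k, 1) =>
      if h : k.val = 0 then Sum.inl (D.corner v 1) else Sum.inr ⟨k.val - 1, by omega⟩
  | Sum.inl (Sum.inr _, 2) => Sum.inl (D.corner v 2)
  | Sum.inl (Sum.inr k, 3) =>
      if h : k.val < m then Sum.inr ⟨k.val, h⟩ else Sum.inl (D.corner v 3)
  | Sum.inr (p, i) => Sum.inl (D.region (Sum.inr (p, i)))

theorem twistOfOld_injective : Function.Injective (D.twistOfOld v m) := by
  rintro (⟨x, i⟩ | ⟨p, i⟩) (⟨y, j⟩ | ⟨q, j⟩) h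
  · by_cases hx : x = v <;> by_cases hy : y = v <;> simp_all [twistOfOld]
  · by_cases hx : x = v <;> simp_all [twistOfOld]
  · by_cases hy : y = v <;> simp_all [twistOfOld]
  · simpa [twistOfOld] using h

theorem twistRegion_ofOld (d : D.Dart) :
    D.twistRegion v m (D.twistOfOld v m d) = Sum.inl (D.region d) := by
  rcases d with ⟨x, i⟩ | ⟨p, i⟩
  · by_cases hx : x = v
    · subst hx
      fin_cases i <;> simp [twistOfOld, twistRegion]
    · simp [twistOfOld, twistRegion, hx]
  · rfl

theorem twistRegion_unrot_ofOld (d : D.Dart) :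
    D.twistRegion v m (unrot (D.twistOfOld v m d)) = Sum.inl (D.region (unrot d)) := by
  rcases d with ⟨x, i⟩ | ⟨p, i⟩
  · by_cases hx : x = v
    · subst hx
      fin_cases i
      · change D.twistRegion x m (unrot (D.twistOfOld x m (Sum.inl (x, 0)))) =
          Sum.inl (D.corner x 3)
        have e : (0 : Fin 4) - 1 = 3 := by decide
        simp only [twistOfOld, unrot, dite_true, e]
        simp [twistRegion]
      · change D.twistRegion x m (unrot (D.twistOfOld x m (Sum.inl (x, 1)))) =
          Sum.inl (D.corner x 0)
        simp [twistOfOld, unrot, twistRegion]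
      · change D.twistRegion x m (unrot (D.twistOfOld x m (Sum.inl (x, 2)))) =
          Sum.inl (D.corner x 1)
        simp [twistOfOld, unrot, twistRegion]
      · change D.twistRegion x m (unrot (D.twistOfOld x m (Sum.inl (x, 3)))) =
          Sum.inl (D.corner x 2)
        simp [twistOfOld, unrot, twistRegion]
    · simp [twistOfOld, unrot, twistRegion, hx]
  · rfl

theorem twistEdge_ofOld (d : D.Dart) :
    D.twistEdge v m (D.twistOfOld v m d) = D.twistOfOld v m (D.edge d) := by
  rcases d with ⟨x, i⟩ | ⟨p, i⟩
  · by_cases hx : x = v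
    · subst hx
      fin_cases i
      · change D.twistEdge x m (D.twistOfOld x m (Sum.inl (x, 0))) =
          D.twistOfOld x m (D.edge (Sum.inl (x, 0)))
        simp [twistOfOld, twistEdge]
      · change D.twistEdge x m (D.twistOfOld x m (Sum.inl (x, 1))) =
          D.twistOfOld x m (D.edge (Sum.inl (x, 1)))
        simp [twistOfOld, twistEdge]
      · change D.twistEdge x m (D.twistOfOld x m (Sum.inl (x, 2))) =
          D.twistOfOld x m (D.edge (Sum.inl (x, 2)))
        simp [twistOfOld, twistEdge]
      · change D.twistEdge x m (D.twistOfOld x m (Sum.inl (x, 3))) =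
          D.twistOfOld x m (D.edge (Sum.inl (x, 3)))
        simp [twistOfOld, twistEdge]
    · simp [twistOfOld, twistEdge, hx]
  · rfl

/-- Every dart is either old or one of the two ends of an edge inside the row. -/
theorem twist_cases {motive : LinkDart ({x : D.Crossing // x ≠ v} ⊕ Fin (m + 1)) D.Point → Prop}
    (old : ∀ d, motive (D.twistOfOld v m d))
    (h0 : ∀ k (h : k < m), motive (Sum.inl (Sum.inr ⟨k, by omega⟩, 0)))
    (h1 : ∀ k (h : k < m), motive (Sum.inl (Sum.inr ⟨k + 1, by omega⟩, 1)))
    (h2 : ∀ k (h : k < m), motive (Sum.inl (Sum.inr ⟨k + 1, by omega⟩, 2)))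
    (h3 : ∀ k (h : k < m), motive (Sum.inl (Sum.inr ⟨k, by omega⟩, 3))) (d) : motive d := by
  rcases d with ⟨x | ⟨k, hk⟩, i⟩ | ⟨p, i⟩
  · have := old (Sum.inl (x.1, i))
    simpa [twistOfOld, x.2] using this
  · have o := fun i => old (Sum.inl (v, i))
    simp only [twistOfOld, dite_true] at o
    fin_cases i
    · by_cases h : k < m
      · exact h0 k h
      · have e : k = m := by omega
        subst e
        exact o 0
    · rcases k with _ | k
      · exact o 1
      · exact h1 k (by omega)
    · rcases k with _ | k
      · exact o 2
      · exact h2 k (by omega)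
    · by_cases h : k < m
      · exact h3 k h
      · have e : k = m := by omega
        subst e
        exact o 3
  · exact old (Sum.inr (p, i))

theorem twistEdge_zero (k : ℕ) (h : k < m) :
    D.twistEdge v m (Sum.inl (Sum.inr ⟨k, by omega⟩, 0)) =
      Sum.inl (Sum.inr ⟨k + 1, by omega⟩, 1) := by simp [twistEdge, h]

theorem twistEdge_one (k : ℕ) (h : k < m) :
    D.twistEdge v m (Sum.inl (Sum.inr ⟨k + 1, by omega⟩, 1)) =
      Sum.inl (Sum.inr ⟨k, by omega⟩, 0) := by simp [twistEdge]

theorem twistEdge_two (k : ℕ) (h : k < m) :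
    D.twistEdge v m (Sum.inl (Sum.inr ⟨k + 1, by omega⟩, 2)) =
      Sum.inl (Sum.inr ⟨k, by omega⟩, 3) := by simp [twistEdge]

theorem twistEdge_three (k : ℕ) (h : k < m) :
    D.twistEdge v m (Sum.inl (Sum.inr ⟨k, by omega⟩, 3)) =
      Sum.inl (Sum.inr ⟨k + 1, by omega⟩, 2) := by simp [twistEdge, h]

/-- Both sides of the edges inside the row. -/
theorem twistRegion_row (k : ℕ) (h : k < m) :
    D.twistRegion v m (Sum.inl (Sum.inr ⟨k, by omega⟩, 0)) = Sum.inl (D.corner v 0) ∧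
    D.twistRegion v m (unrot (Sum.inl (Sum.inr ⟨k, by omega⟩, 0))) = Sum.inr ⟨k, h⟩ ∧
    D.twistRegion v m (Sum.inl (Sum.inr ⟨k + 1, by omega⟩, 1)) = Sum.inr ⟨k, h⟩ ∧
    D.twistRegion v m (unrot (Sum.inl (Sum.inr ⟨k + 1, by omega⟩, 1))) =
      Sum.inl (D.corner v 0) ∧
    D.twistRegion v m (Sum.inl (Sum.inr ⟨k + 1, by omega⟩, 2)) = Sum.inl (D.corner v 2) ∧
    D.twistRegion v m (unrot (Sum.inl (Sum.inr ⟨k + 1, by omega⟩, 2))) = Sum.inr ⟨k, h⟩ ∧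
    D.twistRegion v m (Sum.inl (Sum.inr ⟨k, by omega⟩, 3)) = Sum.inr ⟨k, h⟩ ∧
    D.twistRegion v m (unrot (Sum.inl (Sum.inr ⟨k, by omega⟩, 3))) = Sum.inl (D.corner v 2) := by
  have e0 : (0 : Fin 4) - 1 = 3 := by decide
  have e1 : (1 : Fin 4) - 1 = 0 := by decide
  have e2 : (2 : Fin 4) - 1 = 1 := by decide
  have e3 : (3 : Fin 4) - 1 = 2 := by decide
  simp [twistRegion, unrot, e0, e2, e3, h]

theorem twist_jordan (f : LinkDart ({x : D.Crossing // x ≠ v} ⊕ Fin (m + 1)) D.Point → ZMod 2)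
    (hf : ∀ d, f (D.twistEdge v m d) = f d)
    (hx : ∀ x, ∑ i : Fin 4, f (Sum.inl (x, i)) = 0)
    (hp : ∀ p, ∑ i : Fin 2, f (Sum.inr (p, i)) = 0) :
    ∃ c : D.Region ⊕ Fin m → ZMod 2, ∀ d,
      f d = c (D.twistRegion v m d) + c (D.twistRegion v m (unrot d)) := by
  have hflow : ∀ k (h : k ≤ m),
      f (Sum.inl (Sum.inr ⟨k, by omega⟩, 1)) + f (Sum.inl (Sum.inr ⟨k, by omega⟩, 2)) =
        f (Sum.inl (Sum.inr 0, 1)) + f (Sum.inl (Sum.inr 0, 2)) := by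
    intro k
    induction k with
    | zero => intro _; rfl
    | succ k ih =>
      intro h
      rw [← ih (by omega)]
      have a0 := hf (Sum.inl (Sum.inr ⟨k, by omega⟩, 0))
      have a3 := hf (Sum.inl (Sum.inr ⟨k, by omega⟩, 3))
      rw [D.twistEdge_zero v m k (by omega)] at a0
      rw [D.twistEdge_three v m k (by omega)] at a3
      have hk := hx (Sum.inr ⟨k, by omega⟩)
      rw [Fin.sum_univ_four] at hk
      rw [a0, a3]
      revert hk
      generalize f _ = a
      generalize f _ = b
      generalize f _ = c
      generalize f _ = d
      revert a b c d; decide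
  have hflow2 : ∀ k (h : k ≤ m),
      f (Sum.inl (Sum.inr ⟨k, by omega⟩, 0)) + f (Sum.inl (Sum.inr ⟨k, by omega⟩, 3)) =
        f (Sum.inl (Sum.inr 0, 1)) + f (Sum.inl (Sum.inr 0, 2)) := by
    intro k h
    rw [← hflow k h]
    have hk := hx (Sum.inr ⟨k, by omega⟩)
    rw [Fin.sum_univ_four] at hk
    revert hk
    generalize f _ = a
    generalize f _ = b
    generalize f _ = c
    generalize f _ = d
    revert a b c d; decide
  obtain ⟨c, hc⟩ := D.jordan (fun d => f (D.twistOfOld v m d))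
    (by
      intro d
      have h := hf (D.twistOfOld v m d)
      rwa [twistEdge_ofOld] at h)
    (by
      intro x
      by_cases h : x = v
      · subst h
        have e := hflow2 m le_rfl
        rw [Fin.sum_univ_four]
        simp only [twistOfOld, dite_true]
        change f (Sum.inl (Sum.inr (Fin.last m), 0)) + f (Sum.inl (Sum.inr 0, 1)) +
          f (Sum.inl (Sum.inr 0, 2)) + f (Sum.inl (Sum.inr (Fin.last m), 3)) = 0
        change f (Sum.inl (Sum.inr (Fin.last m), 0)) + f (Sum.inl (Sum.inr (Fin.last m), 3)) = _
          at e
        revert e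
        generalize f _ = a
        generalize f _ = b
        generalize f _ = c
        generalize f _ = d
        revert a b c d; decide
      · have := hx (Sum.inl ⟨x, h⟩)
        simpa [twistOfOld, h] using this)
    hp
  have hNS : f (Sum.inl (Sum.inr 0, 1)) + f (Sum.inl (Sum.inr 0, 2)) =
      c (D.corner v 0) + c (D.corner v 2) := by
    have b1 := hc (Sum.inl (v, 1))
    have b2 := hc (Sum.inl (v, 2))
    simp only [twistOfOld, dite_true] at b1 b2
    change f (Sum.inl (Sum.inr 0, 1)) = c (D.corner v 1) + c (D.corner v 0) at b1
    change f (Sum.inl (Sum.inr 0, 2)) = c (D.corner v 2) + c (D.corner v 1) at b2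
    rw [b1, b2]
    generalize c _ = a
    generalize c _ = b
    generalize c _ = d
    revert a b d; decide
  refine ⟨Sum.elim c fun j => c (D.corner v 0) + f (Sum.inl (Sum.inr j.castSucc, 0)), ?_⟩
  intro d
  have fin : ∀ a b x y : ZMod 2, a + b = x + y → b = x + a + y ∧ b = y + (x + a) := by decide
  have fin2 : ∀ a x : ZMod 2, a = x + (x + a) ∧ a = x + a + x := by decide
  refine D.twist_cases v m (motive := fun d => f d = Sum.elim c _ (D.twistRegion v m d) +
    Sum.elim c _ (D.twistRegion v m (unrot d))) ?_ ?_ ?_ ?_ ?_ d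
  · intro d
    rw [twistRegion_ofOld, twistRegion_unrot_ofOld]
    exact hc d
  · intro k h
    obtain ⟨r0, r1, -⟩ := D.twistRegion_row v m k h
    rw [r0, r1]
    exact (fin2 _ _).1
  · intro k h
    obtain ⟨-, -, r0, r1, -⟩ := D.twistRegion_row v m k h
    rw [r0, r1, ← hf, D.twistEdge_one v m k h]
    exact (fin2 _ _).2
  · intro k h
    obtain ⟨-, -, -, -, r0, r1, -⟩ := D.twistRegion_row v m k h
    rw [r0, r1, ← hf, D.twistEdge_two v m k h]
    exact (fin _ _ _ _ ((hflow2 k h.le).trans hNS)).2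
  · intro k h
    obtain ⟨-, -, -, -, -, -, r0, r1⟩ := D.twistRegion_row v m k h
    rw [r0, r1]
    exact (fin _ _ _ _ ((hflow2 k h.le).trans hNS)).1

/-- The diagram obtained from `D` by replacing the vertex `v` with a horizontal row of `m + 1`
crossings, whose overcrossing strands all go from northeast to southwest (`b = true`) or all
from northwest to southeast (`b = false`). -/
def twist (b : Bool) : LinkDiagram where
  Crossing := {x : D.Crossing // x ≠ v} ⊕ Fin (m + 1)
  Point := D.Point
  Region := D.Region ⊕ Fin m
  edge := D.twistEdge v m
  edge_edge d := by
    refine D.twist_cases v m (motive := fun d => D.twistEdge v m (D.twistEdge v m d) = d)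
      ?_ ?_ ?_ ?_ ?_ d
    · intro d
      rw [twistEdge_ofOld, twistEdge_ofOld, D.edge_edge]
    · intro k h
      rw [D.twistEdge_zero v m k h, D.twistEdge_one v m k h]
    · intro k h
      rw [D.twistEdge_one v m k h, D.twistEdge_zero v m k h]
    · intro k h
      rw [D.twistEdge_two v m k h, D.twistEdge_three v m k h]
    · intro k h
      rw [D.twistEdge_three v m k h, D.twistEdge_two v m k h]
  edge_ne d := by
    refine D.twist_cases v m (motive := fun d => D.twistEdge v m d ≠ d) ?_ ?_ ?_ ?_ ?_ d
    · intro d h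
      rw [twistEdge_ofOld] at h
      exact D.edge_ne d (D.twistOfOld_injective v m h)
    · intro k h
      rw [D.twistEdge_zero v m k h]
      simp
    · intro k h
      rw [D.twistEdge_one v m k h]
      simp
    · intro k h
      rw [D.twistEdge_two v m k h]
      simp
    · intro k h
      rw [D.twistEdge_three v m k h]
      simp
  overEven := Sum.elim (fun x => D.overEven x.1) fun _ => b
  region := D.twistRegion v m
  region_face d := by
    refine D.twist_cases v m (motive := fun d => D.twistRegion v m (unrot (D.twistEdge v m d)) =
      D.twistRegion v m d) ?_ ?_ ?_ ?_ ?_ d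
    · intro d
      rw [twistEdge_ofOld, twistRegion_unrot_ofOld, twistRegion_ofOld, D.region_face]
    · intro k h
      obtain ⟨a0, a1, a2, a3, a4, a5, a6, a7⟩ := D.twistRegion_row v m k h
      rw [D.twistEdge_zero v m k h, a0, a3]
    · intro k h
      obtain ⟨a0, a1, a2, a3, a4, a5, a6, a7⟩ := D.twistRegion_row v m k h
      rw [D.twistEdge_one v m k h, a1, a2]
    · intro k h
      obtain ⟨a0, a1, a2, a3, a4, a5, a6, a7⟩ := D.twistRegion_row v m k h
      rw [D.twistEdge_two v m k h, a4, a7]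
    · intro k h
      obtain ⟨a0, a1, a2, a3, a4, a5, a6, a7⟩ := D.twistRegion_row v m k h
      rw [D.twistEdge_three v m k h, a5, a6]
  connected c hc := by
    have key := D.connected (fun r => c (Sum.inl r)) (by
      intro d
      have h := hc (D.twistOfOld v m d)
      rwa [twistRegion_ofOld, twistRegion_unrot_ofOld] at h)
    have key2 : ∀ r, c r = c (Sum.inl (D.corner v 0)) := by
      rintro (r | ⟨k, h⟩)
      · exact key _ _
      · obtain ⟨a0, a1, -⟩ := D.twistRegion_row v m k h
        have e := hc (Sum.inl (Sum.inr ⟨k, by omega⟩, 0))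
        rw [a0, a1] at e
        exact e.symm
    intro r s
    rw [key2 r, key2 s]
  jordan := D.twist_jordan v m
  base := Sum.inl D.base
  white := Sum.elim D.white fun _ => D.white (D.corner v 1)
  white_ne d := by
    have w0 : D.white (D.corner v 0) ≠ D.white (D.corner v 1) := (D.white_ne (Sum.inl (v, 1))).symm
    have w2 : D.white (D.corner v 2) ≠ D.white (D.corner v 1) := D.white_ne (Sum.inl (v, 2))
    refine D.twist_cases v m (motive := fun d => Sum.elim D.white _ (D.twistRegion v m d) ≠
      Sum.elim D.white _ (D.twistRegion v m (unrot d))) ?_ ?_ ?_ ?_ ?_ d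
    · intro d
      rw [twistRegion_ofOld, twistRegion_unrot_ofOld]
      exact D.white_ne d
    · intro k h
      obtain ⟨a0, a1, a2, a3, a4, a5, a6, a7⟩ := D.twistRegion_row v m k h
      rw [a0, a1]
      exact w0
    · intro k h
      obtain ⟨a0, a1, a2, a3, a4, a5, a6, a7⟩ := D.twistRegion_row v m k h
      rw [a2, a3]
      exact w0.symm
    · intro k h
      obtain ⟨a0, a1, a2, a3, a4, a5, a6, a7⟩ := D.twistRegion_row v m k h
      rw [a4, a5]
      exact w2
    · intro k h
      obtain ⟨a0, a1, a2, a3, a4, a5, a6, a7⟩ := D.twistRegion_row v m k h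
      rw [a6, a7]
      exact w2.symm
  white_base := D.white_base

end twist

/-! ### The `n`-move -/

/-- A link diagram together with a disk whose boundary circle it meets in four points is
represented by the diagram `D` with the vertex `v` to which the disk is contracted; what is
over and what is under at `v` is irrelevant. The darts `0, 1, 2, 3` of `v` leave the disk in the
northeast, northwest, southwest, southeast, and so the corners `0, 1, 2, 3` of `v` are the
northern, western, southern and eastern region.

`D.nMove v n` is the diagram `L_n`, for which the disk is filled with a horizontal row of `|n|`
crossings, with the strands from northwest to southeast on top if `n > 0`, and those from northeast
to southwest if `n < 0`. For `n = 0`, the diagram `L_0` has two horizontal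
arcs in the disk. -/
def nMove (D : LinkDiagram) (v : D.Crossing) : ℤ → LinkDiagram
  | Int.ofNat 0 => D.smooth v 0
  | Int.ofNat (m + 1) => D.twist v m false
  | Int.negSucc m => D.twist v m true

/-- The diagram `L_∞`, for which the disk is filled with two vertical arcs. -/
def infinityMove (D : LinkDiagram) (v : D.Crossing) : LinkDiagram := D.smooth v 1

/-- The dart of `L_n` which comes from a dart outside the disk (a dart of `v` starts on the
boundary of the disk). -/
def nMoveDart (D : LinkDiagram) (v : D.Crossing) : (n : ℤ) → D.Dart → (D.nMove v n).Dart
  | Int.ofNat 0 => D.smoothOfOld v 0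
  | Int.ofNat (m + 1) => D.twistOfOld v m
  | Int.negSucc m => D.twistOfOld v m

/-- The orientations of `L_m` and `L_n` agree outside the disk. -/
def AgreeOutside (D : LinkDiagram) (v : D.Crossing) {m n : ℤ} (o : Orientation (D.nMove v m))
    (o' : Orientation (D.nMove v n)) : Prop :=
  ∀ d, o.out (D.nMoveDart v m d) = o'.out (D.nMoveDart v n d)

/-- The two horizontal strings of `L_0` in the disk are parallel: at their eastern ends both of
them run out of the disk, or both of them run into it. Otherwise they are anti-parallel. -/
def IsParallel (D : LinkDiagram) (v : D.Crossing) (o : Orientation (D.nMove v 0)) : Prop :=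
  o.out (D.nMoveDart v 0 (Sum.inl (v, 0))) = o.out (D.nMoveDart v 0 (Sum.inl (v, 3)))

end LinkDiagram

/-! The Goeritz form is an energy. Call a real function on the regions a potential if it vanishes on
the black regions and on the unbounded one. The real quadratic form of `G(L)` sends a potential X to
the sum over the crossings of η times the squared difference of X at the two opposite white corners
(`equivalent_energy`). The diagrams to be compared differ only inside the disk, so each form is
expressed through the energy of the remaining crossings, `outerEnergy`.

Suppose that the northern region N and the southern region S are white. The bigons of the row are
black, all `L_n` have the same potentials, and the form of `L_n` is `outerEnergy` plus n(X_N - X_S)²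
(`nMove_energy_equivalent`). In `L_∞` the regions N and S are merged, so its form is the restriction
to X_N = X_S. Adding a nonnegative multiple of a square raises the positive index and lowers the
negative one by at most one each; restricting to the kernel of a linear form lowers each index by at
most one. This gives (A)(ii) and (A)(iii). For (A)(i), a unimodular change of basis turns the square
into a single diagonal entry whose cofactor is `det G(L_∞)` (`det_add_smul_vecMulVec_self`).

If N and S are black, the bigons are white and carry new variables. On the potentials with equal
values in the west and the east, which are the potentials of `L_0`, the row adds a negative definite
form in the bigon variables; this subspace has codimension at most one (`index_bounds_of_black`).

For oriented links, all crossings of the row have the same type, determined by the colour of N and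
by whether the strings are parallel (`mu_twist`). The shift of μ combines with the index bounds to
the same interval for either colour. A crossing change alters the form by twice a square, and at a
positive crossing the sign η determines the type (`IsPositive.eta_eq`). -/

/-! ### Indices of inertia under linear maps, and the rank of a symmetric matrix -/

section SignatureComparison

variable {M M' : Type*} [AddCommGroup M] [Module ℝ M] [FiniteDimensional ℝ M]
  [AddCommGroup M'] [Module ℝ M'] [FiniteDimensional ℝ M']
  {Q : QuadraticForm ℝ M} {Q' : QuadraticForm ℝ M'}

/-- On a maximal positive definite subspace for `Q` the map `f` is injective, since `Q ≤ 0` at any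
kernel vector; the image of that subspace is positive definite for `Q'`. -/
theorem sigPos_le_of_le_comp (f : M →ₗ[ℝ] M') (h : ∀ x, Q x ≤ Q' (f x)) :
    sigPos Q ≤ sigPos Q' := by
  obtain ⟨V, hV, hpos⟩ := exists_finrank_eq_sigPos_and_posDef Q
  have hp : ∀ x ∈ V, x ≠ 0 → 0 < Q x := fun x hx h0 => by
    simpa using hpos ⟨x, hx⟩ (by simpa using h0)
  have hinj : Function.Injective (f.domRestrict V) := by
    rw [← LinearMap.ker_eq_bot, LinearMap.ker_eq_bot']
    rintro ⟨x, hx⟩ hfx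
    by_contra hne
    have h0 := hp x hx (by simpa using hne)
    have h1 := h x
    rw [LinearMap.domRestrict_apply] at hfx
    rw [hfx, QuadraticMap.map_zero] at h1
    linarith
  rw [← hV, ← LinearMap.finrank_range_of_inj hinj]
  refine le_sigPos_of_posDef Q' ?_
  rintro ⟨_, ⟨x, hx⟩, rfl⟩ hne
  have hx0 : x ≠ 0 := by
    rintro rfl
    exact hne (by ext; simp)
  exact (hp x hx hx0).trans_le (h x)

/-- A positive definite subspace for `Q'` loses at most `d` dimensions when it is intersected with
the range of `f`, and what is left pulls back to a positive definite subspace for `Q`. -/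
theorem sigPos_le_add_of_comp_le (f : M →ₗ[ℝ] M') (hf : Function.Injective f) {d : ℕ}
    (hd : Module.finrank ℝ M' ≤ Module.finrank ℝ M + d) (h : ∀ x, Q' (f x) ≤ Q x) :
    sigPos Q' ≤ sigPos Q + d := by
  obtain ⟨V, hV, hpos⟩ := exists_finrank_eq_sigPos_and_posDef Q'
  have hle : Module.finrank ℝ (V.comap f) ≤ sigPos Q := by
    refine le_sigPos_of_posDef Q ?_
    rintro ⟨x, hx⟩ hne
    refine lt_of_lt_of_le ?_ (h x)
    refine hpos ⟨f x, hx⟩ fun h0 => hne ?_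
    have : f x = 0 := congrArg Subtype.val h0
    exact Subtype.ext (hf (by simpa using this))
  have h1 : Module.finrank ℝ (V.comap f) = Module.finrank ℝ ↥(V ⊓ f.range) := by
    rw [(Submodule.equivMapOfInjective f hf _).finrank_eq, Submodule.map_comap_eq, inf_comm]
  have h2 := Submodule.finrank_sup_add_finrank_inf_eq V f.range
  have h3 := LinearMap.finrank_range_of_inj hf
  have h4 := Submodule.finrank_le (V ⊔ f.range)
  omega

theorem sigNeg_le_of_comp_le (f : M →ₗ[ℝ] M') (h : ∀ x, Q' (f x) ≤ Q x) :
    sigNeg Q ≤ sigNeg Q' := by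
  rw [← sigPos_neg, ← sigPos_neg]
  exact sigPos_le_of_le_comp f fun x => by simpa using h x

theorem sigNeg_le_add_of_le_comp (f : M →ₗ[ℝ] M') (hf : Function.Injective f) {d : ℕ}
    (hd : Module.finrank ℝ M' ≤ Module.finrank ℝ M + d) (h : ∀ x, Q x ≤ Q' (f x)) :
    sigNeg Q' ≤ sigNeg Q + d := by
  rw [← sigPos_neg, ← sigPos_neg]
  exact sigPos_le_add_of_comp_le f hf hd fun x => by simpa using h x

end SignatureComparison

theorem Submodule.finrank_le_finrank_inf_ker_add_one {K M : Type*} [Field K] [AddCommGroup M]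
    [Module K M] [FiniteDimensional K M] (V : Submodule K M) (l : M →ₗ[K] K) :
    Module.finrank K V ≤ Module.finrank K ↥(V ⊓ LinearMap.ker l) + 1 := by
  have h1 := (l.domRestrict V).finrank_range_add_finrank_ker
  have h2 := Submodule.finrank_le (l.domRestrict V).range
  rw [Module.finrank_self] at h2
  have h3 : Module.finrank K (LinearMap.ker (l.domRestrict V)) =
      Module.finrank K ↥(V ⊓ LinearMap.ker l) := by
    rw [(Submodule.equivMapOfInjective V.subtype V.injective_subtype _).finrank_eq,
      ← Submodule.map_comap_subtype]
    rfl
  omega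

/-- The radical of the form is the kernel of the matrix, so both sides are the size minus the
nullity. -/
theorem Matrix.IsSymm.sigPos_add_sigNeg {n : Type*} [Fintype n] [DecidableEq n]
    {A : Matrix n n ℝ} (hA : A.IsSymm) :
    sigPos A.toQuadraticForm' + sigNeg A.toQuadraticForm' = A.rank := by
  have h1 := QuadraticForm.sigPos_add_sigNeg_add_radical (Q := A.toQuadraticForm')
  have h2 := A.mulVecLin.finrank_range_add_finrank_ker
  have h3 : A.toQuadraticForm'.radical = LinearMap.ker A.mulVecLin := by
    have h : ∀ x, A.toQuadraticForm' x = x ⬝ᵥ A *ᵥ x := fun x => by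
      simp [toQuadraticForm', toLinearMap₂'_apply']
    have hs : ∀ x y, x ⬝ᵥ A *ᵥ y = y ⬝ᵥ A *ᵥ x := fun x y => by
      rw [dotProduct_mulVec, ← mulVec_transpose, hA.eq, dotProduct_comm]
    ext x
    rw [QuadraticMap.mem_radical_iff', LinearMap.mem_ker, mulVecLin_apply]
    simp only [h, mulVec_add, dotProduct_add, add_dotProduct]
    constructor
    · rintro ⟨h0, h1⟩
      -- Testing against `A *ᵥ x` itself makes the squared length of `A *ᵥ x` vanish.
      have h2 := h1 (A *ᵥ x)
      rw [h0, hs x] at h2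
      have : (A *ᵥ x) ⬝ᵥ (A *ᵥ x) = 0 := by linarith
      exact dotProduct_self_eq_zero.mp this
    · intro h0
      refine ⟨by simp [h0], fun y => ?_⟩
      rw [hs x y, h0]
      simp
  rw [h3] at h1
  rw [Matrix.rank]
  omega

/-! ### The Goeritz form as the energy of potentials -/

namespace LinkDiagram

variable (D : LinkDiagram)

theorem white_corner_succ (x : D.Crossing) (k : Fin 4) :
    D.white (D.corner x (k + 1)) = !D.white (D.corner x k) := by
  have h := D.white_ne (Sum.inl (x, k + 1))
  simp only [unrot, add_sub_cancel_right] at h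
  exact Bool.eq_not_of_ne h

theorem white_corner_one (x : D.Crossing) :
    D.white (D.corner x 1) = !D.white (D.corner x 0) := D.white_corner_succ x 0

theorem white_corner_two (x : D.Crossing) :
    D.white (D.corner x 2) = D.white (D.corner x 0) := D.smooth_white x 0

theorem white_corner_three (x : D.Crossing) :
    D.white (D.corner x 3) = !D.white (D.corner x 0) := by
  rw [show (3 : Fin 4) = 2 + 1 from rfl, white_corner_succ, white_corner_two]

/-- The difference of the indicator functions of the opposite corners `k` and `k + 2` at `x`. -/
def cornerDiff (x : D.Crossing) (k : Fin 4) (r : D.Region) : ℤ :=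
  (if D.corner x k = r then 1 else 0) - (if D.corner x (k + 2) = r then 1 else 0)

theorem sum_cornerDiff (x : D.Crossing) (k : Fin 4) :
    ∑ r : D.WhiteRegion, D.cornerDiff x k r.1 = 0 := by
  have h : ∀ c : D.Region, ∑ r : D.WhiteRegion, (if c = r.1 then (1 : ℤ) else 0) =
      if D.white c = true then 1 else 0 := by
    intro c
    split_ifs with hc
    · rw [Finset.sum_eq_single ⟨c, hc⟩] <;> aesop
    · exact Finset.sum_eq_zero fun r _ => if_neg fun e : c = r.1 => hc (e ▸ r.2)
  simp only [cornerDiff, Finset.sum_sub_distrib]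
  rw [h, h, D.smooth_white, sub_self]

/-- Only one pair of opposite corners is white, and the other pair contributes nothing at white
regions. As `r ≠ s`, the product for the white pair is `-1` if these corners lie in `r` and `s`, and
`0` otherwise; in particular a crossing whose white corners lie in one region counts for nothing on
either side. -/
theorem cornerDiff_mul_add (x : D.Crossing) {r s : D.Region} (hr : D.white r = true)
    (hs : D.white s = true) (hrs : r ≠ s) :
    D.cornerDiff x 0 r * D.cornerDiff x 0 s + D.cornerDiff x 1 r * D.cornerDiff x 1 s =
      -(if D.Connects x r s then 1 else 0) := by
  have h1 := D.white_corner_one x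
  have h2 := D.white_corner_two x
  have h3 := D.white_corner_three x
  have e2 : (0 : Fin 4) + 2 = 2 := rfl
  have e3 : (1 : Fin 4) + 2 = 3 := rfl
  have e4 : (2 : Fin 4) + 2 = 0 := rfl
  have e5 : (3 : Fin 4) + 2 = 1 := rfl
  have hC : D.Connects x r s ↔ (D.corner x 0 = r ∧ D.corner x 2 = s) ∨
      (D.corner x 1 = r ∧ D.corner x 3 = s) ∨ (D.corner x 2 = r ∧ D.corner x 0 = s) ∨
      (D.corner x 3 = r ∧ D.corner x 1 = s) := by
    constructor
    · rintro ⟨k, hk⟩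
      fin_cases k
      · exact Or.inl hk
      · exact Or.inr (Or.inl hk)
      · exact Or.inr (Or.inr (Or.inl hk))
      · exact Or.inr (Or.inr (Or.inr hk))
    · rintro (h | h | h | h)
      exacts [⟨0, h⟩, ⟨1, h⟩, ⟨2, h⟩, ⟨3, h⟩]
  simp only [hC, cornerDiff, e2, e3]
  generalize D.corner x 0 = a at *
  generalize D.corner x 1 = b at *
  generalize D.corner x 2 = c at *
  generalize D.corner x 3 = d at *
  split_ifs <;> grind

theorem goeritzEntry_eq {r s : D.WhiteRegion} (hrs : r ≠ s) :
    D.goeritzEntry r s = ∑ x, D.eta x * (D.cornerDiff x 0 r.1 * D.cornerDiff x 0 s.1 +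
      D.cornerDiff x 1 r.1 * D.cornerDiff x 1 s.1) := by
  rw [goeritzEntry, Finset.sum_filter, ← Finset.sum_neg_distrib]
  refine Finset.sum_congr rfl fun x _ => ?_
  rw [D.cornerDiff_mul_add x r.2 s.2 fun h => hrs (Subtype.ext h)]
  split_ifs <;> simp

/-- The formula for the off-diagonal entries persists on the diagonal because the rows of both
matrices sum to zero, for the right-hand side by `sum_cornerDiff`. -/
theorem unreducedGoeritz_apply (r s : D.WhiteRegion) :
    D.unreducedGoeritz r s = ∑ x, D.eta x * (D.cornerDiff x 0 r.1 * D.cornerDiff x 0 s.1 +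
      D.cornerDiff x 1 r.1 * D.cornerDiff x 1 s.1) := by
  simp only [unreducedGoeritz, of_apply]
  split_ifs with h
  · subst h
    have hz : ∑ t : D.WhiteRegion, ∑ x, D.eta x *
        (D.cornerDiff x 0 r.1 * D.cornerDiff x 0 t.1 +
          D.cornerDiff x 1 r.1 * D.cornerDiff x 1 t.1) = 0 := by
      rw [Finset.sum_comm]
      refine Finset.sum_eq_zero fun x _ => ?_
      rw [← Finset.mul_sum, Finset.sum_add_distrib, ← Finset.mul_sum, ← Finset.mul_sum,
        sum_cornerDiff, sum_cornerDiff]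
      simp
    rw [← Finset.add_sum_erase _ _ (Finset.mem_univ r)] at hz
    have he : (Finset.univ.filter fun t : D.WhiteRegion => t ≠ r) = Finset.univ.erase r := by
      ext; simp
    rw [he, Finset.sum_congr rfl fun t ht => D.goeritzEntry_eq (Finset.ne_of_mem_erase ht).symm]
    linarith
  · exact D.goeritzEntry_eq h

theorem goeritz_apply (i j : {r : D.WhiteRegion // r ≠ D.baseWhite}) :
    D.goeritz i j = ∑ x, D.eta x * (D.cornerDiff x 0 i.1.1 * D.cornerDiff x 0 j.1.1 +
      D.cornerDiff x 1 i.1.1 * D.cornerDiff x 1 j.1.1) :=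
  D.unreducedGoeritz_apply _ _

theorem realGoeritz_isSymm : D.realGoeritz.IsSymm := by
  ext i j
  simp only [realGoeritz, transpose_apply, map_apply, goeritz_apply, mul_comm]

/-- The functions on the regions which vanish on the black regions and on the unbounded region. -/
def potentials : Submodule ℝ (D.Region → ℝ) where
  carrier := {X | (∀ r, D.white r = false → X r = 0) ∧ X D.base = 0}
  zero_mem' := by simp
  add_mem' := by
    rintro X Y ⟨h1, h2⟩ ⟨h3, h4⟩
    exact ⟨fun r hr => by simp [h1 r hr, h3 r hr], by simp [h2, h4]⟩
  smul_mem' := by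
    rintro a X ⟨h1, h2⟩
    exact ⟨fun r hr => by simp [h1 r hr], by simp [h2]⟩

/-- The difference of the values in two regions, as a linear form. -/
def regionDiff (r s : D.Region) : (D.Region → ℝ) →ₗ[ℝ] ℝ :=
  (LinearMap.proj r : (D.Region → ℝ) →ₗ[ℝ] ℝ) - LinearMap.proj s

@[simp]
theorem regionDiff_apply (r s : D.Region) (X : D.Region → ℝ) :
    D.regionDiff r s X = X r - X s := rfl

/-- The contribution of a crossing to the energy, up to its sign. -/
noncomputable def crossingForm (x : D.Crossing) : QuadraticForm ℝ (D.Region → ℝ) :=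
  QuadraticMap.sq.comp (D.regionDiff (D.corner x 0) (D.corner x 2)) +
    QuadraticMap.sq.comp (D.regionDiff (D.corner x 1) (D.corner x 3))

theorem crossingForm_apply (x : D.Crossing) (X : D.Region → ℝ) :
    D.crossingForm x X = (X (D.corner x 0) - X (D.corner x 2)) ^ 2 +
      (X (D.corner x 1) - X (D.corner x 3)) ^ 2 := by
  simp [crossingForm, sq]

/-- The quadratic form on the functions on the regions which restricts to the Goeritz form on the
potentials. -/
noncomputable def energy : QuadraticForm ℝ (D.Region → ℝ) :=
  ∑ x, (D.eta x : ℝ) • D.crossingForm x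

theorem energy_apply (X : D.Region → ℝ) :
    D.energy X = ∑ x, (D.eta x : ℝ) * ((X (D.corner x 0) - X (D.corner x 2)) ^ 2 +
      (X (D.corner x 1) - X (D.corner x 3)) ^ 2) := by
  simp [energy, crossingForm_apply]

/-- The extension of a function on the bounded white regions by zero. -/
def extendPotential (y : {r : D.WhiteRegion // r ≠ D.baseWhite} → ℝ) (r : D.Region) : ℝ :=
  if h : D.white r = true ∧ r ≠ D.base then
    y ⟨⟨r, h.1⟩, fun e => h.2 (congrArg Subtype.val e)⟩ else 0

theorem extendPotential_apply (y : {r : D.WhiteRegion // r ≠ D.baseWhite} → ℝ)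
    (i : {r : D.WhiteRegion // r ≠ D.baseWhite}) : D.extendPotential y i.1.1 = y i :=
  dif_pos ⟨i.1.2, fun e => i.2 (Subtype.ext e)⟩

/-- Potentials are functions on the bounded white regions. -/
def potentialsEquiv :
    ({r : D.WhiteRegion // r ≠ D.baseWhite} → ℝ) ≃ₗ[ℝ] D.potentials where
  toFun y := ⟨D.extendPotential y, fun r hr => dif_neg (by simp [hr]), dif_neg (by simp)⟩
  invFun X i := X.1 i.1.1
  map_add' y z := by
    ext r
    simp only [extendPotential, Submodule.coe_add, Pi.add_apply]
    split_ifs <;> simp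
  map_smul' a y := by
    ext r
    simp only [extendPotential, Submodule.coe_smul, Pi.smul_apply, RingHom.id_apply]
    split_ifs <;> simp
  left_inv y := by
    ext i
    exact D.extendPotential_apply y i
  right_inv X := by
    ext r
    simp only [extendPotential]
    split_ifs with h
    · rfl
    · obtain ⟨X, h1, h2⟩ := X
      rw [not_and_or, not_not, Bool.not_eq_true] at h
      rcases h with h | h
      · exact (h1 r h).symm
      · subst h
        exact h2.symm

theorem sum_cornerDiff_mul (x : D.Crossing) (k : Fin 4)
    (y : {r : D.WhiteRegion // r ≠ D.baseWhite} → ℝ) :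
    ∑ i, (D.cornerDiff x k i.1.1 : ℝ) * y i =
      D.extendPotential y (D.corner x k) - D.extendPotential y (D.corner x (k + 2)) := by
  have h : ∀ c : D.Region, ∑ i : {r : D.WhiteRegion // r ≠ D.baseWhite},
      (if c = i.1.1 then (1 : ℝ) else 0) * y i = D.extendPotential y c := by
    intro c
    rw [extendPotential]
    split_ifs with hc
    · rw [Finset.sum_eq_single ⟨⟨c, hc.1⟩, fun e => hc.2 (congrArg Subtype.val e)⟩]
      · simp
      · intro i _ hi
        rw [if_neg, zero_mul]
        rintro rfl
        exact hi rfl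
      · simp
    · refine Finset.sum_eq_zero fun i _ => ?_
      rw [if_neg, zero_mul]
      rintro rfl
      exact hc ⟨i.1.2, fun e => i.2 (Subtype.ext e)⟩
  simp only [cornerDiff, Int.cast_sub, Int.cast_ite, Int.cast_one, Int.cast_zero, sub_mul,
    Finset.sum_sub_distrib, h]

theorem realGoeritz_toQuadraticForm'_apply (y : {r : D.WhiteRegion // r ≠ D.baseWhite} → ℝ) :
    D.realGoeritz.toQuadraticForm' y = D.energy (D.extendPotential y) := by
  rw [energy_apply]
  simp only [toQuadraticForm', LinearMap.BilinMap.toQuadraticMap_apply, toLinearMap₂'_apply']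
  have h : ∀ x, (D.eta x : ℝ) * ((D.extendPotential y (D.corner x 0) -
      D.extendPotential y (D.corner x 2)) ^ 2 + (D.extendPotential y (D.corner x 1) -
      D.extendPotential y (D.corner x 3)) ^ 2) = ∑ i, ∑ j, y i * ((D.eta x : ℝ) *
        ((D.cornerDiff x 0 i.1.1 : ℝ) * D.cornerDiff x 0 j.1.1 +
          D.cornerDiff x 1 i.1.1 * D.cornerDiff x 1 j.1.1)) * y j := by
    intro x
    have h0 := D.sum_cornerDiff_mul x 0 y
    have h1 := D.sum_cornerDiff_mul x 1 y
    rw [show (0 : Fin 4) + 2 = 2 from rfl] at h0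
    rw [show (1 : Fin 4) + 2 = 3 from rfl] at h1
    rw [← h0, ← h1, sq, sq, Finset.sum_mul_sum, Finset.sum_mul_sum, ← Finset.sum_add_distrib,
      Finset.mul_sum]
    refine Finset.sum_congr rfl fun i _ => ?_
    rw [← Finset.sum_add_distrib, Finset.mul_sum]
    exact Finset.sum_congr rfl fun j _ => by ring
  simp only [h]
  rw [Finset.sum_comm]
  simp only [dotProduct, mulVec, Finset.mul_sum]
  refine Finset.sum_congr rfl fun i _ => ?_
  rw [Finset.sum_comm]
  refine Finset.sum_congr rfl fun j _ => ?_
  simp only [realGoeritz, map_apply, goeritz_apply, Int.cast_sum, Int.cast_mul, Int.cast_add,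
    Finset.mul_sum, Finset.sum_mul, mul_assoc]

/-- The Goeritz form is the energy of potentials. -/
theorem equivalent_energy :
    D.realGoeritz.toQuadraticForm'.Equivalent (D.energy.restrict D.potentials) :=
  ⟨{ D.potentialsEquiv with
      map_app' := fun y => (D.realGoeritz_toQuadraticForm'_apply y).symm }⟩

/-- The positive index of inertia of the energy of potentials. -/
noncomputable def posIndex : ℕ := sigPos (D.energy.restrict D.potentials)

/-- The negative index of inertia of the energy of potentials. -/
noncomputable def negIndex : ℕ := sigNeg (D.energy.restrict D.potentials)

theorem goeritzSignature_eq : D.goeritzSignature = (D.posIndex : ℤ) - D.negIndex := by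
  rw [goeritzSignature, D.equivalent_energy.sigPos_eq, D.equivalent_energy.sigNeg_eq]
  rfl

theorem goeritzRank_eq : D.goeritzRank = D.posIndex + D.negIndex := by
  rw [goeritzRank, ← D.realGoeritz_isSymm.sigPos_add_sigNeg, D.equivalent_energy.sigPos_eq,
    D.equivalent_energy.sigNeg_eq]
  rfl

end LinkDiagram

/-! ### Orthogonal sums with a negative form, and rank one changes -/

section SignatureProd

variable {M Y : Type*} [AddCommGroup M] [Module ℝ M] [FiniteDimensional ℝ M]
  [AddCommGroup Y] [Module ℝ Y] [FiniteDimensional ℝ Y]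
  {Q : QuadraticForm ℝ M} {Q' : QuadraticForm ℝ (M × Y)} {P : Y → ℝ}

/-- The projection to `M` does not decrease the form and the inclusion of `M` preserves it. -/
theorem sigPos_eq_of_prod_apply_eq_sub (hP : ∀ y, 0 ≤ P y) (h : ∀ x y, Q' (x, y) = Q x - P y) :
    sigPos Q' = sigPos Q := by
  have hP0 : P 0 = 0 := by
    have h0 := h 0 0
    rw [← Prod.zero_eq_mk, QuadraticMap.map_zero, QuadraticMap.map_zero] at h0
    linarith
  refine le_antisymm (sigPos_le_of_le_comp (LinearMap.fst ℝ M Y) ?_)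
    (sigPos_le_of_le_comp (LinearMap.inl ℝ M Y) fun x => ?_)
  · rintro ⟨x, y⟩
    rw [h, LinearMap.fst_apply]
    linarith [hP y]
  · rw [LinearMap.inl_apply, h, hP0, sub_zero]

/-- The inclusion of `M` has codimension `dim Y`, which bounds the index from above. If `V` is
negative definite for `Q`, then `V × Y` is negative definite for `Q'`, which bounds it from below.
-/
theorem sigNeg_eq_of_prod_apply_eq_sub (hP : ∀ y, y ≠ 0 → 0 < P y)
    (h : ∀ x y, Q' (x, y) = Q x - P y) : sigNeg Q' = sigNeg Q + Module.finrank ℝ Y := by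
  have hP0 : P 0 = 0 := by
    have h0 := h 0 0
    rw [← Prod.zero_eq_mk, QuadraticMap.map_zero, QuadraticMap.map_zero] at h0
    linarith
  refine le_antisymm (sigNeg_le_add_of_le_comp (LinearMap.inl ℝ M Y) LinearMap.inl_injective
    (by rw [Module.finrank_prod]) fun x => ?_) ?_
  · rw [LinearMap.inl_apply, h, hP0, sub_zero]
  · obtain ⟨V, hV, hneg⟩ := exists_finrank_eq_sigNeg_and_negDef Q
    have hinj : Function.Injective (V.subtype.prodMap (LinearMap.id : Y →ₗ[ℝ] Y)) :=
      Function.Injective.prodMap V.injective_subtype Function.injective_id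
    rw [← hV, ← Module.finrank_prod, ← LinearMap.finrank_range_of_inj hinj]
    refine le_sigNeg_of_negDef Q' ?_
    rintro ⟨_, ⟨⟨x, y⟩, rfl⟩⟩ hne
    have hQ' : (-Q') (x.1, y) = (-Q) x.1 + P y := by
      change -Q' (x.1, y) = -Q x.1 + P y
      rw [h]
      ring
    change 0 < (-Q') (x.1, y)
    rw [hQ']
    by_cases hx : x = 0
    · subst hx
      have hy : y ≠ 0 := by
        rintro rfl
        exact hne (by ext <;> simp)
      simpa using hP y hy
    · have hx' : 0 < (-Q) x.1 := hneg x hx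
      by_cases hy : y = 0
      · rw [hy, hP0, add_zero]
        exact hx'
      · exact add_pos hx' (hP y hy)

end SignatureProd

section RankOneChange

variable {M : Type*} [AddCommGroup M] [Module ℝ M] [FiniteDimensional ℝ M]
  {Q Q' : QuadraticForm ℝ M}

/-- On `V` one has `Q ≤ Q'`, and the two forms coincide on the kernel of `l`, of codimension at most
one in `V`. Comparing both with their common restriction limits each change to one. -/
theorem index_bounds_of_add_sq (V : Submodule ℝ M) (l : M →ₗ[ℝ] ℝ) {a : ℝ} (ha : 0 ≤ a)
    (h : ∀ x ∈ V, Q' x = Q x + a * l x ^ 2) :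
    sigPos (Q.restrict V) ≤ sigPos (Q'.restrict V) ∧
    sigPos (Q'.restrict V) ≤ sigPos (Q.restrict V) + 1 ∧
    sigNeg (Q'.restrict V) ≤ sigNeg (Q.restrict V) ∧
    sigNeg (Q.restrict V) ≤ sigNeg (Q'.restrict V) + 1 := by
  have hle : ∀ x : V, Q.restrict V x ≤ Q'.restrict V x := by
    rintro ⟨x, hx⟩
    change Q x ≤ Q' x
    rw [h x hx]
    nlinarith [sq_nonneg (l x)]
  have hker : ∀ x : ↥(V ⊓ LinearMap.ker l), Q' x.1 = Q x.1 := by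
    rintro ⟨x, hx, hl⟩
    replace hl : l x = 0 := hl
    change Q' x = Q x
    rw [h x hx, hl]
    ring
  have hinj := Submodule.inclusion_injective (inf_le_left : V ⊓ LinearMap.ker l ≤ V)
  have hd := V.finrank_le_finrank_inf_ker_add_one l
  have p1 := sigPos_le_of_le_comp (Q := Q.restrict (V ⊓ LinearMap.ker l)) (Q' := Q.restrict V)
    (Submodule.inclusion inf_le_left) fun x => le_rfl
  have p2 := sigPos_le_add_of_comp_le (Q := Q.restrict (V ⊓ LinearMap.ker l))
    (Q' := Q'.restrict V) (Submodule.inclusion inf_le_left) hinj hd fun x => (hker x).le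
  have n1 := sigNeg_le_of_comp_le (Q := Q.restrict (V ⊓ LinearMap.ker l))
    (Q' := Q'.restrict V) (Submodule.inclusion inf_le_left) fun x => (hker x).le
  have n2 := sigNeg_le_add_of_le_comp (Q := Q.restrict (V ⊓ LinearMap.ker l))
    (Q' := Q.restrict V) (Submodule.inclusion inf_le_left) hinj hd fun x => le_rfl
  have p3 := sigPos_le_of_le_comp (Q := Q.restrict V) (Q' := Q'.restrict V) LinearMap.id hle
  have n3 := sigNeg_le_of_comp_le (Q := Q'.restrict V) (Q' := Q.restrict V) LinearMap.id hle
  omega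

theorem index_bounds_of_inf_ker (V : Submodule ℝ M) (l : M →ₗ[ℝ] ℝ) :
    sigPos (Q.restrict (V ⊓ LinearMap.ker l)) ≤ sigPos (Q.restrict V) ∧
    sigPos (Q.restrict V) ≤ sigPos (Q.restrict (V ⊓ LinearMap.ker l)) + 1 ∧
    sigNeg (Q.restrict (V ⊓ LinearMap.ker l)) ≤ sigNeg (Q.restrict V) ∧
    sigNeg (Q.restrict V) ≤ sigNeg (Q.restrict (V ⊓ LinearMap.ker l)) + 1 := by
  have hinj := Submodule.inclusion_injective (inf_le_left : V ⊓ LinearMap.ker l ≤ V)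
  have hd := V.finrank_le_finrank_inf_ker_add_one l
  exact ⟨sigPos_le_of_le_comp (Submodule.inclusion inf_le_left) fun x => le_rfl,
    sigPos_le_add_of_comp_le (Submodule.inclusion inf_le_left) hinj hd fun x => le_rfl,
    sigNeg_le_of_comp_le (Submodule.inclusion inf_le_left) fun x => le_rfl,
    sigNeg_le_add_of_le_comp (Submodule.inclusion inf_le_left) hinj hd fun x => le_rfl⟩

end RankOneChange

/-! ### Energies of smoothed and twisted diagrams -/

namespace LinkDiagram

variable (D : LinkDiagram) (v : D.Crossing)

/-- The energy without the contribution of the crossing `v`. -/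
noncomputable def outerEnergy : QuadraticForm ℝ (D.Region → ℝ) :=
  ∑ x : {x : D.Crossing // x ≠ v}, (D.eta x.1 : ℝ) • D.crossingForm x.1

theorem outerEnergy_apply (X : D.Region → ℝ) :
    D.outerEnergy v X =
      ∑ x : {x : D.Crossing // x ≠ v}, (D.eta x.1 : ℝ) * D.crossingForm x.1 X := by
  simp [outerEnergy]

theorem energy_eq_outerEnergy_add (X : D.Region → ℝ) :
    D.energy X = D.outerEnergy v X + D.eta v * D.crossingForm v X := by
  rw [outerEnergy_apply, energy_apply, Fintype.sum_eq_add_sum_subtype_ne _ v, add_comm]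
  simp only [crossingForm_apply]

section smooth

variable (s : Fin 4)

theorem eta_smooth (x : {x : D.Crossing // x ≠ v}) : (D.smooth v s).eta x = D.eta x.1 := by
  have h : (D.smooth v s).white ((D.smooth v s).corner x 0) = D.white (D.corner x.1 0) :=
    D.smoothMerge_comp v s D.white (D.smooth_white_corners v s) _
  simp only [eta, h]
  rfl

/-- The potentials of a smoothed diagram are the potentials of the diagram which agree on the two
merged regions. -/
def smoothPotentialsEquiv : (D.smooth v s).potentials ≃ₗ[ℝ]
    ↥(D.potentials ⊓ LinearMap.ker (D.regionDiff (D.corner v (s + 1)) (D.corner v (s + 3)))) where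
  toFun X := ⟨fun r => X.1 ⟨D.smoothMerge v s r, Set.mem_range_self _⟩,
    ⟨fun r hr => X.2.1 _ ((D.smoothMerge_comp v s D.white (D.smooth_white_corners v s) r).trans hr),
      X.2.2⟩, by
      change X.1 _ - X.1 _ = 0
      rw [sub_eq_zero]
      exact congrArg X.1 (Subtype.ext (D.smoothMerge_corner v s).symm)⟩
  invFun Y := ⟨fun r => Y.1 r.1, fun r hr => Y.2.1.1 r.1 hr, by
    change Y.1 (D.smoothMerge v s D.base) = 0
    rw [D.smoothMerge_comp v s Y.1 (sub_eq_zero.mp Y.2.2)]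
    exact Y.2.1.2⟩
  map_add' _ _ := rfl
  map_smul' _ _ := rfl
  left_inv X := by
    ext ⟨_, r, rfl⟩
    change X.1 _ = X.1 _
    -- It remains to see that `smoothMerge` is idempotent.
    simp only [smoothMerge, identify]
    grind
  right_inv Y := by
    ext r
    exact D.smoothMerge_comp v s Y.1 (sub_eq_zero.mp Y.2.2) r

theorem smooth_energy_equivalent :
    ((D.smooth v s).energy.restrict (D.smooth v s).potentials).Equivalent
      ((D.outerEnergy v).restrict (D.potentials ⊓
        LinearMap.ker (D.regionDiff (D.corner v (s + 1)) (D.corner v (s + 3))))) := by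
  refine ⟨{ D.smoothPotentialsEquiv v s with map_app' := fun X => ?_ }⟩
  change D.outerEnergy v (fun r => X.1 ⟨D.smoothMerge v s r, Set.mem_range_self _⟩) =
    (D.smooth v s).energy X.1
  rw [outerEnergy_apply, energy_apply]
  refine Finset.sum_congr rfl fun x _ => ?_
  rw [eta_smooth, crossingForm_apply]
  rfl

theorem posIndex_smooth : (D.smooth v s).posIndex = sigPos ((D.outerEnergy v).restrict
    (D.potentials ⊓
      LinearMap.ker (D.regionDiff (D.corner v (s + 1)) (D.corner v (s + 3))))) :=
  (D.smooth_energy_equivalent v s).sigPos_eq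

theorem negIndex_smooth : (D.smooth v s).negIndex = sigNeg ((D.outerEnergy v).restrict
    (D.potentials ⊓
      LinearMap.ker (D.regionDiff (D.corner v (s + 1)) (D.corner v (s + 3))))) :=
  (D.smooth_energy_equivalent v s).sigNeg_eq

end smooth

section twist

variable (m : ℕ) (b : Bool)

theorem eta_twist_old (x : {x : D.Crossing // x ≠ v}) :
    (D.twist v m b).eta (Sum.inl x) = D.eta x.1 := rfl

theorem eta_twist_row (k : Fin (m + 1)) :
    (D.twist v m b).eta (Sum.inr k) = if b = !D.white (D.corner v 0) then 1 else -1 := rfl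

theorem twist_energy_apply (Z : (D.twist v m b).Region → ℝ) :
    (D.twist v m b).energy Z = D.outerEnergy v (fun r => Z (Sum.inl r)) +
      ∑ k : Fin (m + 1), (if b = !D.white (D.corner v 0) then 1 else -1) *
        ((Z (Sum.inl (D.corner v 0)) - Z (Sum.inl (D.corner v 2))) ^ 2 +
          (Z (D.twistRegion v m (Sum.inl (Sum.inr k, 1))) -
            Z (D.twistRegion v m (Sum.inl (Sum.inr k, 3)))) ^ 2) := by
  rw [outerEnergy_apply]
  refine ((D.twist v m b).energy_apply Z).trans ((Fintype.sum_sum_type _).trans (congrArg₂ _ ?_ ?_))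
  · refine Finset.sum_congr rfl fun x _ => ?_
    rw [eta_twist_old, crossingForm_apply]
    rfl
  · refine Finset.sum_congr rfl fun k _ => ?_
    rw [eta_twist_row]
    push_cast
    rfl

theorem white_twistRegion_one (k : Fin (m + 1)) :
    (D.twist v m b).white (D.twistRegion v m (Sum.inl (Sum.inr k, 1))) =
      D.white (D.corner v 1) := by
  simp only [twistRegion]
  split_ifs <;> rfl

theorem white_twistRegion_three (k : Fin (m + 1)) :
    (D.twist v m b).white (D.twistRegion v m (Sum.inl (Sum.inr k, 3))) =
      D.white (D.corner v 1) := by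
  have h : D.white (D.corner v 3) = D.white (D.corner v 1) := D.smooth_white v 1
  simp only [twistRegion]
  split_ifs
  · rfl
  · exact h

/-- If the bigons are black, the potentials of the diagram with a row of crossings are those of
the diagram. -/
def twistPotentialsEquiv (h : D.white (D.corner v 0) = true) :
    (D.twist v m b).potentials ≃ₗ[ℝ] D.potentials where
  toFun Z := ⟨fun r => Z.1 (Sum.inl r), fun r hr => Z.2.1 (Sum.inl r) hr, Z.2.2⟩
  invFun X := ⟨Sum.elim X.1 0, fun r hr => by
    rcases r with r | j
    · exact X.2.1 r hr
    · rfl, X.2.2⟩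
  map_add' _ _ := rfl
  map_smul' _ _ := rfl
  left_inv Z := by
    ext (r | j)
    · rfl
    · refine (Z.2.1 (Sum.inr j) ?_).symm
      change D.white (D.corner v 1) = false
      rw [white_corner_one, h]
      rfl
  right_inv _ := rfl

/-- With black bigons, a potential vanishes at the western and eastern corners of every crossing of
the row. Each of the `m + 1` crossings then contributes the same square with the same sign. -/
theorem twist_energy_equivalent (h : D.white (D.corner v 0) = true) :
    ((D.twist v m b).energy.restrict (D.twist v m b).potentials).Equivalent
      ((D.outerEnergy v + ((m + 1) * if b = false then 1 else -1 : ℝ) •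
        QuadraticMap.sq.comp (D.regionDiff (D.corner v 0) (D.corner v 2))).restrict
          D.potentials) := by
  refine ⟨{ D.twistPotentialsEquiv v m b h with map_app' := fun Z => ?_ }⟩
  have hb : D.white (D.corner v 1) = false := by rw [white_corner_one, h]; rfl
  have h1 : ∀ k, Z.1 (D.twistRegion v m (Sum.inl (Sum.inr k, 1))) = 0 := fun k =>
    Z.2.1 _ ((D.white_twistRegion_one v m b k).trans hb)
  have h3 : ∀ k, Z.1 (D.twistRegion v m (Sum.inl (Sum.inr k, 3))) = 0 := fun k =>
    Z.2.1 _ ((D.white_twistRegion_three v m b k).trans hb)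
  refine Eq.trans ?_ (D.twist_energy_apply v m b Z.1).symm
  simp only [h1, h3, h]
  change D.outerEnergy v (fun r => Z.1 (Sum.inl r)) + ((m + 1) * if b = false then 1 else -1) *
    ((Z.1 (Sum.inl (D.corner v 0)) - Z.1 (Sum.inl (D.corner v 2))) *
      (Z.1 (Sum.inl (D.corner v 0)) - Z.1 (Sum.inl (D.corner v 2)))) = _
  simp only [Finset.sum_const, Finset.card_univ, Fintype.card_fin,
    nsmul_eq_mul, Bool.not_true]
  push_cast
  ring

end twist

theorem potentials_inf_ker_of_black {r s : D.Region} (hr : D.white r = false)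
    (hs : D.white s = false) : D.potentials ⊓ LinearMap.ker (D.regionDiff r s) = D.potentials := by
  refine inf_eq_left.mpr fun X hX => ?_
  rw [LinearMap.mem_ker, regionDiff_apply, hX.1 r hr, hX.1 s hs, sub_self]

/-- If the northern and the southern regions are white, the Goeritz form of `L_n` differs from the
one of `L_0` by `n` times the square of a linear form. -/
theorem nMove_energy_equivalent (h : D.white (D.corner v 0) = true) (n : ℤ) :
    ((D.nMove v n).energy.restrict (D.nMove v n).potentials).Equivalent
      ((D.outerEnergy v + (n : ℝ) •
        QuadraticMap.sq.comp (D.regionDiff (D.corner v 0) (D.corner v 2))).restrict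
          D.potentials) := by
  rcases n with (_ | m) | m
  · have e := D.smooth_energy_equivalent v 0
    -- In `L_0` the western and eastern regions are merged. They are black, so their merging imposes
    -- no condition on potentials.
    rw [D.potentials_inf_ker_of_black (by
      rw [show (0 : Fin 4) + 1 = 1 from rfl, white_corner_one, h]; rfl) (by
      rw [show (0 : Fin 4) + 3 = 3 from rfl, white_corner_three, h]; rfl)] at e
    have hc : ((Int.ofNat 0 : ℤ) : ℝ) = 0 := by simp
    rw [hc, zero_smul, add_zero]
    exact e
  · have e := D.twist_energy_equivalent v m false h
    rw [if_pos rfl] at e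
    have hc : ((Int.ofNat (m + 1) : ℤ) : ℝ) = (m + 1) * 1 := by simp
    rw [hc]
    exact e
  · have e := D.twist_energy_equivalent v m true h
    rw [if_neg (by simp)] at e
    have hc : ((Int.negSucc m : ℤ) : ℝ) = (m + 1) * (-1) := by
      rw [Int.cast_negSucc]; push_cast; ring
    rw [hc]
    exact e

end LinkDiagram

/-! ### Rows with white bigons -/

/-- The differences along a path with `m` inner vertices of a function which vanishes at both
ends. -/
def pathDiff {m : ℕ} (y : Fin m → ℝ) (k : Fin (m + 1)) : ℝ :=
  (if h : k.val = 0 then 0 else y ⟨k.val - 1, by omega⟩) -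
    if h : k.val < m then y ⟨k.val, h⟩ else 0

/-- If all differences vanish, the function is constant along the path, with the value zero of its
ends. -/
theorem sum_sq_pathDiff_pos {m : ℕ} {y : Fin m → ℝ} (hy : y ≠ 0) :
    0 < ∑ k, pathDiff y k ^ 2 := by
  refine lt_of_le_of_ne (Finset.sum_nonneg fun _ _ => sq_nonneg _) fun h => hy ?_
  rw [eq_comm, Finset.sum_eq_zero_iff_of_nonneg fun _ _ => sq_nonneg _] at h
  have hd : ∀ k, pathDiff y k = 0 := fun k => pow_eq_zero_iff two_ne_zero |>.mp (h k (by simp))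
  have key : ∀ j (hj : j < m), y ⟨j, hj⟩ = 0 := by
    intro j
    induction j with
    | zero =>
      intro hj
      have := hd ⟨0, by omega⟩
      simpa [pathDiff, hj] using this
    | succ j ih =>
      intro hj
      have := hd ⟨j + 1, by omega⟩
      simpa [pathDiff, hj, ih (by omega)] using this
  ext ⟨j, hj⟩
  exact key j hj

namespace LinkDiagram

variable (D : LinkDiagram) (v : D.Crossing) (m : ℕ)

/-- If the bigons are white, a potential with equal values in the western and the eastern region
and a function on the bigons give a potential of the diagram with a row of crossings. -/
def rowPotential (b : Bool) (h : D.white (D.corner v 1) = true) :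
    ↥(D.potentials ⊓ LinearMap.ker (D.regionDiff (D.corner v 1) (D.corner v 3))) × (Fin m → ℝ)
      →ₗ[ℝ] (D.twist v m b).potentials where
  -- The bigon values are measured from the common value in the west and the east, so that the
  -- differences along the row depend on `p.2` alone.
  toFun p := ⟨Sum.elim p.1.1 fun j => p.2 j + p.1.1 (D.corner v 1), fun r hr => by
    rcases r with r | j
    · exact p.1.2.1.1 r hr
    · exact absurd (h.symm.trans hr) (by simp), p.1.2.1.2⟩
  map_add' p q := by
    ext (r | j)
    · rfl
    · change p.2 j + q.2 j + (p.1.1 _ + q.1.1 _) = p.2 j + p.1.1 _ + (q.2 j + q.1.1 _)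
      ring
  map_smul' a p := by
    ext (r | j)
    · rfl
    · change a * p.2 j + a * p.1.1 _ = a * (p.2 j + p.1.1 _)
      ring

theorem rowPotential_injective (b : Bool) (h : D.white (D.corner v 1) = true) :
    Function.Injective (D.rowPotential v m b h) := by
  intro p q hpq
  have h1 : ∀ r, p.1.1 r = q.1.1 r := fun r =>
    congrFun (congrArg Subtype.val hpq) (Sum.inl r : (D.twist v m b).Region)
  have h2 : ∀ j, p.2 j + p.1.1 (D.corner v 1) = q.2 j + q.1.1 (D.corner v 1) := fun j =>
    congrFun (congrArg Subtype.val hpq) (Sum.inr j : (D.twist v m b).Region)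
  refine Prod.ext (Subtype.ext (funext h1)) (funext fun j => ?_)
  have := h2 j
  rw [h1] at this
  exact add_right_cancel this

/-- Needed to see that the image of `rowPotential` has codimension at most one. -/
theorem finrank_twist_potentials_le (b : Bool) :
    Module.finrank ℝ (D.twist v m b).potentials ≤ Module.finrank ℝ D.potentials + m := by
  let f : (D.twist v m b).potentials →ₗ[ℝ] D.potentials × (Fin m → ℝ) :=
    { toFun := fun Z => (⟨fun r => Z.1 (Sum.inl r), fun r hr => Z.2.1 (Sum.inl r) hr, Z.2.2⟩,
        fun j => Z.1 (Sum.inr j))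
      map_add' := fun _ _ => rfl
      map_smul' := fun _ _ => rfl }
  have hf : Function.Injective f := by
    intro Z Z' hZ
    ext (r | j)
    · exact congrFun (congrArg (fun p => p.1.1) hZ) r
    · exact congrFun (congrArg Prod.snd hZ) j
  have := LinearMap.finrank_le_finrank_of_injective hf
  rwa [Module.finrank_prod, Module.finrank_fin_fun] at this

/-- Here η is `-1` at every crossing of the row, the northern and southern values vanish, and the
differences from west to east at the successive crossings are those of `p.2` along a path with zero
ends. -/
theorem energy_rowPotential (h : D.white (D.corner v 0) = false)
    (h1 : D.white (D.corner v 1) = true)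
    (p : ↥(D.potentials ⊓ LinearMap.ker (D.regionDiff (D.corner v 1) (D.corner v 3))) ×
      (Fin m → ℝ)) :
    (D.twist v m false).energy (D.rowPotential v m false h1 p).1 =
      D.outerEnergy v p.1.1 - ∑ k, pathDiff p.2 k ^ 2 := by
  have hWE : p.1.1 (D.corner v 1) = p.1.1 (D.corner v 3) := sub_eq_zero.mp p.1.2.2
  have hN : p.1.1 (D.corner v 0) = 0 := p.1.2.1.1 _ h
  have hS : p.1.1 (D.corner v 2) = 0 := p.1.2.1.1 _ (by rw [white_corner_two, h])
  refine (D.twist_energy_apply v m false _).trans ?_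
  rw [sub_eq_add_neg (D.outerEnergy v p.1.1), ← Finset.sum_neg_distrib]
  refine congrArg₂ _ rfl (Finset.sum_congr rfl fun k _ => ?_)
  have hd : (D.rowPotential v m false h1 p).1 (D.twistRegion v m (Sum.inl (Sum.inr k, 1))) -
      (D.rowPotential v m false h1 p).1 (D.twistRegion v m (Sum.inl (Sum.inr k, 3))) =
      pathDiff p.2 k := by
    change Sum.elim _ _ (D.twistRegion v m _) - Sum.elim _ _ (D.twistRegion v m _) = _
    simp only [twistRegion, pathDiff]
    split_ifs <;> simp [← hWE]
  rw [hd]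
  change _ * ((p.1.1 (D.corner v 0) - p.1.1 (D.corner v 2)) ^ 2 + _) = _
  rw [hN, hS, h]
  simp

/-- On the image of `rowPotential` the form of the twisted diagram is the sum of that of `L_0` and a
negative definite form in the `m` bigon variables. The negative index gains this `m`; the missing
dimension, at most one, accounts for the slack in each index. -/
theorem index_bounds_of_black (h : D.white (D.corner v 0) = false) :
    (D.smooth v 0).posIndex ≤ (D.twist v m false).posIndex ∧
    (D.twist v m false).posIndex ≤ (D.smooth v 0).posIndex + 1 ∧
    (D.smooth v 0).negIndex + m ≤ (D.twist v m false).negIndex ∧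
    (D.twist v m false).negIndex ≤ (D.smooth v 0).negIndex + m + 1 := by
  have h1 : D.white (D.corner v 1) = true := by rw [white_corner_one, h]; rfl
  rw [posIndex_smooth, negIndex_smooth, posIndex, negIndex]
  rw [show (0 : Fin 4) + 1 = 1 from rfl, show (0 : Fin 4) + 3 = 3 from rfl]
  let Q' := ((D.twist v m false).energy.restrict (D.twist v m false).potentials).comp
    (D.rowPotential v m false h1)
  have hQ' : ∀ x y, Q' (x, y) = (D.outerEnergy v).restrict _ x - ∑ k, pathDiff y k ^ 2 :=
    fun x y => D.energy_rowPotential v m h h1 (x, y)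
  have hp := sigPos_eq_of_prod_apply_eq_sub
    (fun y => Finset.sum_nonneg fun _ _ => sq_nonneg _) hQ'
  have hn := sigNeg_eq_of_prod_apply_eq_sub (fun y hy => sum_sq_pathDiff_pos hy) hQ'
  rw [Module.finrank_fin_fun] at hn
  rw [← hp, ← hn]
  have hinj := D.rowPotential_injective v m false h1
  have hd := D.finrank_twist_potentials_le v m false
  have hd' := D.potentials.finrank_le_finrank_inf_ker_add_one
    (D.regionDiff (D.corner v 1) (D.corner v 3))
  have hd'' : Module.finrank ℝ (D.twist v m false).potentials ≤ Module.finrank ℝ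
      (↥(D.potentials ⊓ LinearMap.ker (D.regionDiff (D.corner v 1) (D.corner v 3))) ×
        (Fin m → ℝ)) + 1 := by
    rw [Module.finrank_prod, Module.finrank_fin_fun]
    omega
  exact ⟨sigPos_le_of_le_comp _ fun _ => le_rfl,
    sigPos_le_add_of_comp_le _ hinj hd'' fun _ => le_rfl,
    sigNeg_le_of_comp_le _ fun _ => le_rfl,
    sigNeg_le_add_of_le_comp _ hinj hd'' fun _ => le_rfl⟩

end LinkDiagram

/-! ### Unoriented signature bounds for white northern and southern regions -/

namespace LinkDiagram

variable (D : LinkDiagram) (v : D.Crossing)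

section white

theorem nMove_index_bounds (h : D.white (D.corner v 0) = true) {n : ℤ} (hn : 0 ≤ n) :
    (D.nMove v 0).posIndex ≤ (D.nMove v n).posIndex ∧
    (D.nMove v n).posIndex ≤ (D.nMove v 0).posIndex + 1 ∧
    (D.nMove v n).negIndex ≤ (D.nMove v 0).negIndex ∧
    (D.nMove v 0).negIndex ≤ (D.nMove v n).negIndex + 1 := by
  simp only [posIndex, negIndex]
  rw [(D.nMove_energy_equivalent v h n).sigPos_eq, (D.nMove_energy_equivalent v h n).sigNeg_eq,
    (D.nMove_energy_equivalent v h 0).sigPos_eq, (D.nMove_energy_equivalent v h 0).sigNeg_eq]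
  refine index_bounds_of_add_sq D.potentials (D.regionDiff (D.corner v 0) (D.corner v 2))
    (a := n) (by exact_mod_cast hn) fun X _ => ?_
  simp [sq]

theorem nMove_goeritzSignature_bounds (h : D.white (D.corner v 0) = true) {n : ℤ} (hn : 0 ≤ n) :
    (D.nMove v 0).goeritzSignature ≤ (D.nMove v n).goeritzSignature ∧
    (D.nMove v n).goeritzSignature ≤ (D.nMove v 0).goeritzSignature + 2 := by
  have := D.nMove_index_bounds v h hn
  rw [goeritzSignature_eq, goeritzSignature_eq]
  omega

/-- Where the northern and southern values agree the added square vanishes, so the form of `L_∞` is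
a restriction of the form of `L_n` for every `n` at once. -/
theorem infinityMove_index_bounds (h : D.white (D.corner v 0) = true) (n : ℤ) :
    (D.infinityMove v).posIndex ≤ (D.nMove v n).posIndex ∧
    (D.nMove v n).posIndex ≤ (D.infinityMove v).posIndex + 1 ∧
    (D.infinityMove v).negIndex ≤ (D.nMove v n).negIndex ∧
    (D.nMove v n).negIndex ≤ (D.infinityMove v).negIndex + 1 := by
  have hker : LinearMap.ker (D.regionDiff (D.corner v 2) (D.corner v 0)) =
      LinearMap.ker (D.regionDiff (D.corner v 0) (D.corner v 2)) := by
    ext X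
    rw [LinearMap.mem_ker, LinearMap.mem_ker, regionDiff_apply, regionDiff_apply, sub_eq_zero,
      sub_eq_zero, eq_comm]
  have hQ : (D.outerEnergy v).restrict (D.potentials ⊓
      LinearMap.ker (D.regionDiff (D.corner v 0) (D.corner v 2))) =
      (D.outerEnergy v + (n : ℝ) •
        QuadraticMap.sq.comp (D.regionDiff (D.corner v 0) (D.corner v 2))).restrict
          (D.potentials ⊓ LinearMap.ker (D.regionDiff (D.corner v 0) (D.corner v 2))) := by
    ext X
    have hX : D.regionDiff (D.corner v 0) (D.corner v 2) X.1 = 0 := X.2.2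
    change D.outerEnergy v X.1 = D.outerEnergy v X.1 + n * (_ * _)
    rw [hX]
    simp
  rw [infinityMove, posIndex_smooth, negIndex_smooth, show (1 : Fin 4) + 1 = 2 from rfl,
    show (1 : Fin 4) + 3 = 0 from rfl, hker, hQ, posIndex, negIndex,
    (D.nMove_energy_equivalent v h n).sigPos_eq, (D.nMove_energy_equivalent v h n).sigNeg_eq]
  exact index_bounds_of_inf_ker _ _

theorem nMove_infinityMove_signature (h : D.white (D.corner v 0) = true) (n : ℤ) :
    |(D.nMove v n).goeritzSignature - (D.infinityMove v).goeritzSignature| ≤ 1 ∧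
    ((D.nMove v n).goeritzSignature = (D.infinityMove v).goeritzSignature ↔
      ((D.nMove v n).goeritzRank = (D.infinityMove v).goeritzRank ∨
        (D.nMove v n).goeritzRank = (D.infinityMove v).goeritzRank + 2)) := by
  have := D.infinityMove_index_bounds v h n
  rw [goeritzSignature_eq, goeritzSignature_eq, goeritzRank_eq, goeritzRank_eq, abs_le]
  -- Each index of `L_n` exceeds that of `L_∞` by 0 or 1. The signatures agree if and only if the
  -- two excesses are equal, that is, if their sum, the difference of the ranks, is 0 or 2.
  omega

end white

/-! ### The correction term and the oriented moves -/

namespace Orientation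

variable {D v}

/-- Strands run straight through a crossing, so from one corner to the next both the colour and the
coherence of the bounding darts are reversed. Testing corner 1, which is black exactly when corner 0
is white, is therefore enough. -/
theorem isTypeII_iff (o : Orientation D) (x : D.Crossing) : o.IsTypeII x ↔
    (D.white (D.corner x 0) = true ↔ o.out (Sum.inl (x, 1)) = o.out (Sum.inl (x, 2))) := by
  have h0 : o.out (Sum.inl (x, 2)) = !o.out (Sum.inl (x, 0)) := o.out_crossing x 0
  have h1 : o.out (Sum.inl (x, 3)) = !o.out (Sum.inl (x, 1)) := o.out_crossing x 1
  have e : IsTypeII o x ↔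
      (D.white (D.corner x 0) = false → o.out (Sum.inl (x, 0)) = o.out (Sum.inl (x, 1))) ∧
      (D.white (D.corner x 1) = false → o.out (Sum.inl (x, 1)) = o.out (Sum.inl (x, 2))) ∧
      (D.white (D.corner x 2) = false → o.out (Sum.inl (x, 2)) = o.out (Sum.inl (x, 3))) ∧
      (D.white (D.corner x 3) = false → o.out (Sum.inl (x, 3)) = o.out (Sum.inl (x, 0))) :=
    ⟨fun h => ⟨h 0, h 1, h 2, h 3⟩, fun ⟨a, b, c, d⟩ k => by fin_cases k; exacts [a, b, c, d]⟩
  rw [e, white_corner_one, white_corner_two, white_corner_three, h0, h1]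
  generalize D.white _ = w
  generalize o.out _ = a
  generalize o.out _ = b
  revert w a b
  decide

/-- The contribution of a crossing to the correction term. -/
def muTerm (o : Orientation D) (x : D.Crossing) : ℤ := if o.IsTypeII x then D.eta x else 0

theorem muTerm_eq_ite (o : Orientation D) (x : D.Crossing) {p : Prop} [Decidable p] {a : ℤ}
    (h : o.IsTypeII x ↔ p) (ha : D.eta x = a) : o.muTerm x = if p then a else 0 := by
  rw [muTerm, ha]
  exact if_congr h rfl rfl

theorem muTerm_congr {D' : LinkDiagram} {o : Orientation D} {o' : Orientation D'} {x : D.Crossing}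
    {x' : D'.Crossing} (h : o'.IsTypeII x' ↔ o.IsTypeII x) (he : D'.eta x' = D.eta x) :
    o'.muTerm x' = o.muTerm x :=
  muTerm_eq_ite o' x' h he

theorem mu_eq_sum (o : Orientation D) : o.mu = ∑ x, o.muTerm x := Finset.sum_filter _ _

variable {m : ℕ}

/-- The orientation of the darts at the crossings of the row. -/
def rowOut {b : Bool} (o : Orientation (D.twist v m b)) (k : Fin (m + 1)) (i : Fin 4) : Bool :=
  o.out (Sum.inl (Sum.inr k, i))

/-- Passing through a crossing or along the two edges to the next one reverses both darts together,
so agreement of the two directions propagates along the whole row. It can be read at the eastern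
ends of the row, where `IsParallel` reads it for `L_0`. -/
theorem rowOut_iff {b : Bool} (o : Orientation (D.twist v m b)) (k : Fin (m + 1)) :
    (o.rowOut k 1 = o.rowOut k 2) ↔ o.rowOut (Fin.last m) 0 = o.rowOut (Fin.last m) 3 := by
  have hc : ∀ k : Fin (m + 1), (o.rowOut k 1 = o.rowOut k 2) ↔ o.rowOut k 0 = o.rowOut k 3 := by
    intro k
    have h0 : o.rowOut k 2 = !o.rowOut k 0 := o.out_crossing (Sum.inr k) 0
    have h1 : o.rowOut k 3 = !o.rowOut k 1 := o.out_crossing (Sum.inr k) 1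
    rw [h0, h1]
    generalize o.rowOut _ _ = a
    generalize o.rowOut _ _ = b
    revert a b
    decide
  have key : ∀ j (hj : j < m + 1),
      (o.rowOut ⟨j, hj⟩ 1 = o.rowOut ⟨j, hj⟩ 2) ↔ o.rowOut 0 1 = o.rowOut 0 2 := by
    intro j
    induction j with
    | zero => exact fun _ => Iff.rfl
    | succ j ih =>
      intro hj
      have e1 : o.rowOut ⟨j + 1, hj⟩ 1 = !o.rowOut ⟨j, by omega⟩ 0 :=
        (congrArg o.out (D.twistEdge_zero v m j (by omega))).symm.trans
          (o.out_edge (Sum.inl (Sum.inr ⟨j, by omega⟩, 0)))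
      have e2 : o.rowOut ⟨j + 1, hj⟩ 2 = !o.rowOut ⟨j, by omega⟩ 3 :=
        (congrArg o.out (D.twistEdge_three v m j (by omega))).symm.trans
          (o.out_edge (Sum.inl (Sum.inr ⟨j, by omega⟩, 3)))
      rw [← ih (by omega), hc ⟨j, by omega⟩, e1, e2, Bool.not_inj_iff]
  rw [key k.1 k.2, ← key m (by omega)]
  exact hc (Fin.last m)

/-- The correction terms of diagrams which differ by a row of crossings. -/
theorem mu_twist (o : Orientation (D.smooth v 0)) (o' : Orientation (D.twist v m false))
    (hagree : ∀ d, o.out (D.smoothOfOld v 0 d) = o'.out (D.twistOfOld v m d)) :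
    o'.mu = o.mu + (m + 1) * (if D.white (D.corner v 0) = true ↔
      o.out (D.smoothOfOld v 0 (Sum.inl (v, 0))) = o.out (D.smoothOfOld v 0 (Sum.inl (v, 3)))
      then (if D.white (D.corner v 0) = true then 1 else -1) else 0) := by
  rw [mu_eq_sum, mu_eq_sum]
  refine (Fintype.sum_sum_type _).trans (congrArg₂ _ ?_ ?_)
  · refine Finset.sum_congr rfl fun x _ => ?_
    have hout : ∀ i, o.out (Sum.inl (x, i)) = o'.out (Sum.inl (Sum.inl x, i)) := fun i => by
      have := hagree (Sum.inl (x.1, i))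
      simp only [smoothOfOld, twistOfOld, x.2, dite_false] at this
      exact this
    have hw : (D.smooth v 0).white ((D.smooth v 0).corner x 0) = D.white (D.corner x.1 0) :=
      D.smoothMerge_comp v 0 D.white (D.smooth_white_corners v 0) _
    have hII : o'.IsTypeII (Sum.inl x) ↔ o.IsTypeII x :=
      (isTypeII_iff _ _).trans (Iff.trans (Iff.of_eq (congrArg₂ Iff (congrArg (· = true) hw.symm)
        (congrArg₂ Eq (hout 1).symm (hout 2).symm))) (isTypeII_iff o x).symm)
    exact muTerm_congr hII ((D.eta_twist_old v m false x).trans (D.eta_smooth v 0 x).symm)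
  · have h0 : o.out (D.smoothOfOld v 0 (Sum.inl (v, 0))) = o'.rowOut (Fin.last m) 0 := by
      have e : D.twistOfOld v m (Sum.inl (v, 0)) = Sum.inl (Sum.inr (Fin.last m), 0) := by
        simp [twistOfOld]
      exact (hagree _).trans (congrArg o'.out e)
    have h3 : o.out (D.smoothOfOld v 0 (Sum.inl (v, 3))) = o'.rowOut (Fin.last m) 3 := by
      have e : D.twistOfOld v m (Sum.inl (v, 3)) = Sum.inl (Sum.inr (Fin.last m), 3) := by
        simp [twistOfOld]
      exact (hagree _).trans (congrArg o'.out e)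
    have hterm : ∀ k : Fin (m + 1), o'.muTerm (Sum.inr k) =
        if D.white (D.corner v 0) = true ↔
          o.out (D.smoothOfOld v 0 (Sum.inl (v, 0))) = o.out (D.smoothOfOld v 0 (Sum.inl (v, 3)))
        then (if D.white (D.corner v 0) = true then 1 else -1) else 0 := by
      intro k
      rw [h0, h3]
      have hII : o'.IsTypeII (Sum.inr k) ↔ (D.white (D.corner v 0) = true ↔
          o'.rowOut (Fin.last m) 0 = o'.rowOut (Fin.last m) 3) :=
        (isTypeII_iff o' (Sum.inr k)).trans (iff_congr Iff.rfl (rowOut_iff o' k))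
      rw [muTerm_eq_ite o' (Sum.inr k) hII (D.eta_twist_row v m false k)]
      generalize D.white _ = w
      cases w <;> simp
    refine (Finset.sum_congr rfl fun k _ => hterm k).trans ?_
    rw [Finset.sum_const, Finset.card_univ, Fintype.card_fin, nsmul_eq_mul]
    push_cast
    rfl

/-- Put n = m + 1. If the northern region is white, σ(G) grows by 0 to 2, while μ grows by n for
parallel strings and is unchanged for anti-parallel ones. If it is black, the change of σ(G) lies
between -n and 2 - n, while μ is unchanged for parallel strings and drops by n for anti-parallel
ones. Either colour leads to the same bounds. -/
theorem signature_twist_bounds (o : Orientation (D.smooth v 0))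
    (o' : Orientation (D.twist v m false))
    (hagree : ∀ d, o.out (D.smoothOfOld v 0 d) = o'.out (D.twistOfOld v m d)) :
    (o.out (D.smoothOfOld v 0 (Sum.inl (v, 0))) = o.out (D.smoothOfOld v 0 (Sum.inl (v, 3))) →
      (m + 1 : ℤ) - 2 ≤ o.signature - o'.signature ∧ o.signature - o'.signature ≤ m + 1) ∧
    (¬ o.out (D.smoothOfOld v 0 (Sum.inl (v, 0))) = o.out (D.smoothOfOld v 0 (Sum.inl (v, 3))) →
      0 ≤ o'.signature - o.signature ∧ o'.signature - o.signature ≤ 2) := by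
  rw [signature, signature, mu_twist o o' hagree]
  by_cases hw : D.white (D.corner v 0) = true
  · have hs : (D.smooth v 0).goeritzSignature ≤ (D.twist v m false).goeritzSignature ∧
        (D.twist v m false).goeritzSignature ≤ (D.smooth v 0).goeritzSignature + 2 :=
      D.nMove_goeritzSignature_bounds v hw (n := Int.ofNat (m + 1))
          (Int.natCast_nonneg _)
    constructor <;> intro hpar <;> simp only [hw, hpar] <;> simp <;> omega
  · have hb := D.index_bounds_of_black v m (by simpa using hw)
    rw [goeritzSignature_eq, goeritzSignature_eq]
    constructor <;> intro hpar <;> simp only [hw, hpar] <;> simp <;> omega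

end Orientation

/-- Every dart of `L_0` comes from a dart of `D`, so the two orientations are equal. -/
theorem AgreeOutside.signature_eq {o o' : Orientation (D.nMove v 0)}
    (h : D.AgreeOutside v o o') : o.signature = o'.signature := by
  have hout : o.out = o'.out := by
    funext d
    have e := h (D.smoothToOld v 0 d)
    have e' : D.nMoveDart v 0 (D.smoothToOld v 0 d) = d := D.smoothOfOld_toOld v 0 d
    rwa [e'] at e
  cases o
  cases o'
  cases hout
  rfl

theorem signature_bounds_of_parallel {n : ℤ} (hn : 0 ≤ n) (o : Orientation (D.nMove v 0))
    (o' : Orientation (D.nMove v n)) (h : D.AgreeOutside v o o') (hpar : D.IsParallel v o) :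
    n - 2 ≤ o.signature - o'.signature ∧ o.signature - o'.signature ≤ n := by
  rcases n with (_ | m) | m
  · have := AgreeOutside.signature_eq D v (o := o) (o' := o') h
    change (0 : ℤ) - 2 ≤ _ ∧ _ ≤ (0 : ℤ)
    rw [this]
    omega
  · exact (Orientation.signature_twist_bounds (D := D) (v := v) o o' h).1 hpar
  · exact absurd hn (by simp)

/-- For odd `n` the assertion is vacuous: a strand of `L_n` would join two ends at which the
orientation outside runs into the disk. -/
theorem signature_bounds_of_not_parallel {n : ℤ} (hn : 0 ≤ n) (o : Orientation (D.nMove v 0))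
    (o' : Orientation (D.nMove v n)) (h : D.AgreeOutside v o o') (hpar : ¬ D.IsParallel v o) :
    0 ≤ o'.signature - o.signature ∧ o'.signature - o.signature ≤ 2 := by
  rcases n with (_ | m) | m
  · have := AgreeOutside.signature_eq D v (o := o) (o' := o') h
    rw [this]
    change 0 ≤ o'.signature - o'.signature ∧ o'.signature - o'.signature ≤ 2
    omega
  · exact (Orientation.signature_twist_bounds (D := D) (v := v) o o' h).2 hpar
  · exact absurd hn (by simp)

/-! ### Crossing changes -/

theorem eta_crossingChange (x : D.Crossing) :
    (D.crossingChange v).eta x = if x = v then -D.eta v else D.eta x := by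
  simp only [eta, crossingChange]
  by_cases h : x = v
  · subst h
    simp only [if_true]
    change (if (!D.overEven x) = !D.white (D.corner x 0) then (1 : ℤ) else -1) = _
    generalize D.overEven x = a
    generalize D.white _ = b
    revert a b
    decide
  · simp only [h, if_false]

theorem energy_crossingChange : (D.crossingChange v).energy =
    (D.outerEnergy v - (D.eta v : ℝ) • D.crossingForm v : QuadraticForm ℝ (D.Region → ℝ)) := by
  refine QuadraticMap.ext fun X => ?_
  refine ((D.crossingChange v).energy_eq_outerEnergy_add v X).trans ?_
  rw [eta_crossingChange, if_pos rfl]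
  refine Eq.trans (congrArg₂ _ ?_ ?_) (sub_eq_add_neg (D.outerEnergy v X) _).symm
  · refine ((D.crossingChange v).outerEnergy_apply v X).trans (Eq.trans
      (Finset.sum_congr rfl fun x _ => ?_) (D.outerEnergy_apply v X).symm)
    exact congrArg₂ (fun (a : ℤ) (b : ℝ) => (a : ℝ) * b)
      ((D.eta_crossingChange v x.1).trans (if_neg x.2)) rfl
  · push_cast
    rw [neg_mul]
    rfl

theorem posIndex_crossingChange : (D.crossingChange v).posIndex =
    sigPos ((D.outerEnergy v - (D.eta v : ℝ) • D.crossingForm v).restrict D.potentials) :=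
  congrArg (fun Q : QuadraticForm ℝ (D.Region → ℝ) => sigPos (Q.restrict D.potentials))
    (D.energy_crossingChange v)

theorem negIndex_crossingChange : (D.crossingChange v).negIndex =
    sigNeg ((D.outerEnergy v - (D.eta v : ℝ) • D.crossingForm v).restrict D.potentials) :=
  congrArg (fun Q : QuadraticForm ℝ (D.Region → ℝ) => sigNeg (Q.restrict D.potentials))
    (D.energy_crossingChange v)

/-- One of the two pairs of opposite corners is black, and potentials vanish there. -/
theorem crossingForm_eq_sq : ∃ l : (D.Region → ℝ) →ₗ[ℝ] ℝ, ∀ X ∈ D.potentials,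
    D.crossingForm v X = l X ^ 2 := by
  have h1 := D.white_corner_one v
  have h2 := D.white_corner_two v
  have h3 := D.white_corner_three v
  by_cases h : D.white (D.corner v 0) = true
  · refine ⟨D.regionDiff (D.corner v 0) (D.corner v 2), fun X hX => ?_⟩
    rw [crossingForm_apply, regionDiff_apply, hX.1 (D.corner v 1) (by simp [h1, h]),
      hX.1 (D.corner v 3) (by simp [h3, h])]
    ring
  · refine ⟨D.regionDiff (D.corner v 1) (D.corner v 3), fun X hX => ?_⟩
    rw [crossingForm_apply, regionDiff_apply, hX.1 (D.corner v 0) (by simpa using h),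
      hX.1 (D.corner v 2) (by simpa [h2] using h)]
    ring

theorem crossingChange_goeritzSignature_bounds :
    (D.eta v = 1 → (D.crossingChange v).goeritzSignature ≤ D.goeritzSignature ∧
      D.goeritzSignature ≤ (D.crossingChange v).goeritzSignature + 2) ∧
    (D.eta v = -1 → D.goeritzSignature ≤ (D.crossingChange v).goeritzSignature ∧
      (D.crossingChange v).goeritzSignature ≤ D.goeritzSignature + 2) := by
  obtain ⟨l, hl⟩ := D.crossingForm_eq_sq v
  rw [goeritzSignature_eq, goeritzSignature_eq, posIndex_crossingChange, negIndex_crossingChange,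
    posIndex, negIndex]
  have hc : ∀ X, (D.outerEnergy v - (D.eta v : ℝ) • D.crossingForm v) X =
      D.outerEnergy v X - D.eta v * D.crossingForm v X := fun _ => rfl
  constructor
  · intro h
    -- The constant 2 is the difference between the coefficients `1` and `-1` of the square in the
    -- two diagrams.
    have b := index_bounds_of_add_sq (Q' := D.energy)
      (Q := D.outerEnergy v - (D.eta v : ℝ) • D.crossingForm v)
      D.potentials l (a := 2) (by norm_num) fun X hX => by
        rw [hc, D.energy_eq_outerEnergy_add v X, hl X hX, h]
        push_cast
        ring
    omega
  · intro h
    have b := index_bounds_of_add_sq (Q := D.energy)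
      (Q' := D.outerEnergy v - (D.eta v : ℝ) • D.crossingForm v)
      D.potentials l (a := 2) (by norm_num) fun X hX => by
        rw [hc, D.energy_eq_outerEnergy_add v X, hl X hX, h]
        push_cast
        ring
    omega

namespace Orientation

variable {D v}

theorem mu_crossingChange (o : Orientation D) :
    (o.crossingChange v).mu = o.mu - 2 * if o.IsTypeII v then D.eta v else 0 := by
  have hII : ∀ x, (o.crossingChange v).IsTypeII x ↔ o.IsTypeII x := fun x => Iff.rfl
  have h : ∀ x : D.Crossing, (o.crossingChange v).muTerm x =
      if x = v then -o.muTerm v else o.muTerm x := by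
    intro x
    refine (muTerm_eq_ite (o.crossingChange v) x (hII x)
      (D.eta_crossingChange v x)).trans ?_
    unfold muTerm
    by_cases hx : x = v
    · subst hx
      split_ifs <;> simp
    · rw [if_neg hx, if_neg hx]
  have e : (o.crossingChange v).mu = ∑ x : D.Crossing, if x = v then -o.muTerm v else o.muTerm x :=
    (mu_eq_sum _).trans (Finset.sum_congr rfl fun x _ => h x)
  rw [e, mu_eq_sum, Fintype.sum_eq_add_sum_subtype_ne _ v,
    Fintype.sum_eq_add_sum_subtype_ne (fun x => o.muTerm x) v,
    Finset.sum_congr rfl fun (x : {x : D.Crossing // x ≠ v}) _ => if_neg x.2]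
  simp only [if_true, muTerm]
  ring

/-- At a positive crossing the corner `k` between the two outgoing darts is swept by the upper
strand. If it is black, then η is `1` and the crossing is of type II; if it is white, then η is `-1`
and each black corner has one incoming and one outgoing dart. -/
theorem IsPositive.eta_eq {o : Orientation D} (h : o.IsPositive v) :
    D.eta v = if o.IsTypeII v then 1 else -1 := by
  obtain ⟨k, hk, hk1, hk2⟩ := h
  have h0 : o.out (Sum.inl (v, 2)) = !o.out (Sum.inl (v, 0)) := o.out_crossing v 0
  have h1 : o.out (Sum.inl (v, 3)) = !o.out (Sum.inl (v, 1)) := o.out_crossing v 1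
  rw [eta, hk]
  simp only [isTypeII_iff]
  rw [h0]
  fin_cases k
  all_goals
    simp only [Fin.reduceFinMk, Fin.zero_eta, Fin.mk_one, Fin.isValue, Fin.reduceAdd, zero_add,
      h0, h1] at hk1 hk2 ⊢
    revert hk1 hk2
    generalize D.white _ = w
    generalize o.out _ = a
    try generalize o.out _ = b
    revert w a
    try revert b
    decide

/-- For type II, σ(G) drops by 0 to 2 and μ drops by exactly 2. For type I, σ(G) rises by 0 to 2 and
μ is unchanged. -/
theorem IsPositive.signature_crossingChange_bounds {o : Orientation D} (h : o.IsPositive v) :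
    0 ≤ (o.crossingChange v).signature - o.signature ∧
    (o.crossingChange v).signature - o.signature ≤ 2 := by
  have hb := D.crossingChange_goeritzSignature_bounds v
  have he := h.eta_eq
  rw [signature, signature, mu_crossingChange]
  by_cases hII : o.IsTypeII v
  · rw [if_pos hII] at he ⊢
    have := hb.1 he
    omega
  · rw [if_neg hII] at he ⊢
    have := hb.2 he
    omega

end Orientation

end LinkDiagram

/-! ### Determinants under a symmetric rank one change -/

section Determinant

variable {J R : Type*} [Fintype J] [DecidableEq J] [CommRing R]

/-- By linearity in the row `p`, the change of the determinant is `a` times that of `B` with this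
row replaced by a unit vector, which is block triangular with blocks 1 and the minor. -/
theorem Matrix.det_add_single_self (B : Matrix J J R) (p : J) (a : R) :
    (B + single p p a).det =
      B.det + a * (B.submatrix (Subtype.val : {j // j ≠ p} → J) Subtype.val).det := by
  have h : B + single p p a = updateRow B p (B p + a • Pi.single p 1) := by
    ext i j
    by_cases hi : i = p
    · subst hi
      by_cases hj : j = i
      · subst hj; simp
      · simp [hj, Ne.symm hj]
    · simp [hi, Ne.symm hi]
  rw [h, det_updateRow_add, det_updateRow_smul, updateRow_eq_self]
  congr 2
  refine (twoBlockTriangular_det' _ (fun j => j = p) ?_).trans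
    (Eq.trans ?_ (one_mul (B.submatrix Subtype.val Subtype.val).det))
  · rintro i rfl j hj
    simp [hj]
  · have hp : ((default : {j // j = p}) : J) = p := (default : {j // j = p}).2
    have h1 : (toSquareBlockProp (B.updateRow p (Pi.single p 1)) fun j => j = p).det = 1 := by
      rw [det_unique, toSquareBlockProp_def, of_apply, hp, updateRow_self, Pi.single_eq_same]
    congr 1
    · convert h1
    · congr 1
      ext i j
      simp [toSquareBlockProp, i.2]

/-- The matrix `T`, the identity with `t` added to the row `p`, has determinant 1 as `t p = 0`. The
conditions on `u` say that `Tᵀ` maps `u` to `u p` times the unit vector at `p`. Congruence by `T`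
thus turns the rank one term into a diagonal entry at `p`, multiplied in the determinant by the
complementary minor of `Tᵀ * A * T`. -/
theorem Matrix.det_add_smul_vecMulVec_self (A : Matrix J J R) (u t : J → R) (p : J)
    (htp : t p = 0) (hu : ∀ j, j ≠ p → u j + t j * u p = 0) (hup : u p * u p = 1) (a : R) :
    (A + a • vecMulVec u u).det = A.det + a * (of fun i j : {j // j ≠ p} =>
      A i j + t i * A p j + t j * A i p + t i * t j * A p p).det := by
  set T : Matrix J J R := 1 + vecMulVec (Pi.single p 1) t with hT
  have hdet : T.det = 1 := by
    rw [hT, vecMulVec_eq Unit, det_one_add_replicateCol_mul_replicateRow]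
    simp [htp]
  have hconj : ∀ (M : Matrix J J R) i j, (Tᵀ * M * T) i j =
      M i j + t i * M p j + t j * M i p + t i * t j * M p p := by
    have hl : ∀ (M : Matrix J J R) i j, (Tᵀ * M) i j = M i j + t i * M p j := fun M i j => by
      simp [hT, mul_apply, add_mul, Finset.sum_add_distrib, one_apply, vecMulVec_apply,
        Pi.single_apply]
    have hr : ∀ (M : Matrix J J R) i j, (M * T) i j = M i j + M i p * t j := fun M i j => by
      simp [hT, mul_apply, mul_add, Finset.sum_add_distrib, one_apply, vecMulVec_apply,
        Pi.single_apply]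
    intro M i j
    rw [hr, hl, hl]
    ring
  have hM : ∀ M : Matrix J J R, (Tᵀ * M * T).det = M.det := fun M => by
    rw [det_mul, det_mul, det_transpose, hdet, one_mul, mul_one]
  have hsplit : Tᵀ * (A + a • vecMulVec u u) * T = Tᵀ * A * T + single p p a := by
    ext i j
    rw [add_apply, hconj, hconj]
    simp only [add_apply, smul_apply, vecMulVec_apply, smul_eq_mul]
    have e : ∀ i, u i + t i * u p = if p = i then u p else 0 := fun i => by
      split_ifs with h
      · rw [← h, htp]; ring
      · exact hu i (Ne.symm h)
    have e2 : single p p a i j = a * ((u i + t i * u p) * (u j + t j * u p)) := by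
      rw [e, e]
      by_cases hi : p = i
      · subst hi
        by_cases hj : p = j
        · subst hj
          simp [hup]
        · simp [hj]
      · simp [hi]
    rw [e2]
    ring
  rw [← hM, hsplit, det_add_single_self, hM]
  congr 3
  ext i j
  exact hconj A i j

end Determinant

/-! ### The determinant formula for `L_n` -/

namespace LinkDiagram

/-- The determinant of the Goeritz matrix, for any indexing of the bounded white regions. -/
theorem det_goeritz_eq (L : LinkDiagram) {J : Type*} [Fintype J] [DecidableEq J]
    (f : J → L.Region) (hf : Function.Injective f)
    (h : ∀ r, (L.white r = true ∧ r ≠ L.base) ↔ ∃ j, f j = r) :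
    L.goeritz.det = (of fun i j => ∑ x, L.eta x *
      (L.cornerDiff x 0 (f i) * L.cornerDiff x 0 (f j) +
        L.cornerDiff x 1 (f i) * L.cornerDiff x 1 (f j))).det := by
  let g : J → {r : L.WhiteRegion // r ≠ L.baseWhite} := fun j =>
    ⟨⟨f j, ((h _).mpr ⟨j, rfl⟩).1⟩, fun e => ((h _).mpr ⟨j, rfl⟩).2 (congrArg Subtype.val e)⟩
  have hg : Function.Bijective g := by
    constructor
    · intro i j hij
      exact hf (congrArg (fun r => r.1.1) hij)
    · rintro ⟨⟨r, hr⟩, hb⟩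
      obtain ⟨j, rfl⟩ := (h r).mp ⟨hr, fun e => hb (Subtype.ext e)⟩
      exact ⟨j, rfl⟩
  rw [← det_submatrix_equiv_self (Equiv.ofBijective g hg)]
  congr 1
  ext i j
  exact L.goeritz_apply _ _

variable (D : LinkDiagram) (v : D.Crossing)

/-- The bounded white regions. -/
abbrev BoundedWhite : Type := {r : D.Region // D.white r = true ∧ r ≠ D.base}

/-- The matrix of the energy without the contribution of the crossing `v`. -/
def outerMatrix : Matrix D.BoundedWhite D.BoundedWhite ℤ :=
  of fun i j => ∑ x : {x : D.Crossing // x ≠ v}, D.eta x.1 *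
    (D.cornerDiff x.1 0 i.1 * D.cornerDiff x.1 0 j.1 +
      D.cornerDiff x.1 1 i.1 * D.cornerDiff x.1 1 j.1)

/-- The difference of the indicator functions of the northern and the southern region. -/
def twistVector (j : D.BoundedWhite) : ℤ := D.cornerDiff v 0 j.1

variable {D} in
theorem cornerDiff_congr {D' : LinkDiagram} {x : D.Crossing} {x' : D'.Crossing} {k : Fin 4}
    {r : D.Region} {r' : D'.Region} (h : D'.corner x' k = r' ↔ D.corner x k = r)
    (h' : D'.corner x' (k + 2) = r' ↔ D.corner x (k + 2) = r) :
    D'.cornerDiff x' k r' = D.cornerDiff x k r := by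
  simp only [cornerDiff, h, h']

variable {D} in
theorem cornerDiff_eq_zero {x : D.Crossing} {k : Fin 4} {r : D.Region} (h : D.corner x k ≠ r)
    (h' : D.corner x (k + 2) ≠ r) : D.cornerDiff x k r = 0 := by
  rw [cornerDiff, if_neg h, if_neg h', sub_zero]

/-- The function `cornerDiff` of a smoothed diagram, as a function of the original regions. -/
def mergedDiff (s : Fin 4) (x : D.Crossing) (k : Fin 4) (r : D.Region) : ℤ :=
  (if D.smoothMerge v s (D.corner x k) = r then 1 else 0) -
    (if D.smoothMerge v s (D.corner x (k + 2)) = r then 1 else 0)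

theorem cornerDiff_smooth (s : Fin 4) (x : {x : D.Crossing // x ≠ v}) (k : Fin 4)
    (r : (D.smooth v s).Region) :
    (D.smooth v s).cornerDiff x k r = D.mergedDiff v s x.1 k r.1 := by
  have h : ∀ k, (D.smooth v s).corner x k = r ↔ D.smoothMerge v s (D.corner x.1 k) = r.1 :=
    fun k => Subtype.ext_iff
  simp only [cornerDiff, mergedDiff, h]

theorem smooth_summand (s : Fin 4) (x : {x : D.Crossing // x ≠ v}) (r r' : (D.smooth v s).Region) :
    (D.smooth v s).eta x * ((D.smooth v s).cornerDiff x 0 r * (D.smooth v s).cornerDiff x 0 r' +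
      (D.smooth v s).cornerDiff x 1 r * (D.smooth v s).cornerDiff x 1 r') =
    D.eta x.1 * (D.mergedDiff v s x.1 0 r.1 * D.mergedDiff v s x.1 0 r'.1 +
      D.mergedDiff v s x.1 1 r.1 * D.mergedDiff v s x.1 1 r'.1) := by
  rw [eta_smooth, cornerDiff_smooth, cornerDiff_smooth, cornerDiff_smooth, cornerDiff_smooth]

/-- The two merged regions are black, so the white regions and their incidences with the remaining
crossings are unaffected. -/
theorem det_goeritz_smooth_zero (h : D.white (D.corner v 0) = true) :
    (D.smooth v 0).goeritz.det = (D.outerMatrix v).det := by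
  have hW : D.white (D.corner v 1) = false := by rw [white_corner_one, h]; rfl
  have hE : D.white (D.corner v 3) = false := by rw [white_corner_three, h]; rfl
  have hm : ∀ r s, D.white s = true → (D.smoothMerge v 0 r = s ↔ r = s) := by
    intro r s hs
    change (if r = D.corner v 3 then D.corner v 1 else r) = s ↔ r = s
    grind
  have hm' : ∀ r, D.white r = true → D.smoothMerge v 0 r = r := fun r hr => (hm r r hr).mpr rfl
  have hb : (D.smooth v 0).base.1 = D.base := hm' _ D.white_base
  rw [(D.smooth v 0).det_goeritz_eq (J := D.BoundedWhite)
    (fun j => ⟨j.1, j.1, hm' _ j.2.1⟩) (fun i j hij => by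
      have := congrArg Subtype.val hij
      exact Subtype.ext this)]
  · congr 1
    ext i j
    refine Finset.sum_congr rfl fun x _ => ?_
    have hd : ∀ k (j : D.BoundedWhite), D.mergedDiff v 0 x.1 k j.1 = D.cornerDiff x.1 k j.1 :=
      fun k j => by simp only [mergedDiff, cornerDiff, hm _ _ j.2.1]
    refine (D.smooth_summand v 0 x _ _).trans ?_
    rw [hd, hd, hd, hd]
  · intro r
    constructor
    · rintro ⟨hr, hrb⟩
      exact ⟨⟨r.1, hr, fun e => hrb (Subtype.ext (e.trans hb.symm))⟩, rfl⟩
    · rintro ⟨j, rfl⟩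
      exact ⟨j.2.1, fun e => j.2.2 ((congrArg Subtype.val e).trans hb)⟩

theorem det_goeritz_twist (h : D.white (D.corner v 0) = true) (m : ℕ) (b : Bool) :
    (D.twist v m b).goeritz.det = (D.outerMatrix v + ((m + 1) * if b = false then 1 else -1 : ℤ) •
      vecMulVec (D.twistVector v) (D.twistVector v)).det := by
  have hW : D.white (D.corner v 1) = false := by rw [white_corner_one, h]; rfl
  have hinl : ∀ r s : D.Region, (Sum.inl r : (D.twist v m b).Region) = Sum.inl s ↔ r = s :=
    fun r s => Sum.inl_injective.eq_iff
  have hold : ∀ (x : {x : D.Crossing // x ≠ v}) k (r : D.Region),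
      (D.twist v m b).cornerDiff (Sum.inl x) k (Sum.inl r) = D.cornerDiff x.1 k r := by
    intro x k r
    exact cornerDiff_congr (hinl _ _) (hinl _ _)
  have hrow : ∀ (k : Fin (m + 1)) (r : D.Region),
      (D.twist v m b).cornerDiff (Sum.inr k) 0 (Sum.inl r) = D.cornerDiff v 0 r := by
    intro k r
    exact cornerDiff_congr (hinl _ _) (hinl _ _)
  have hrow' : ∀ (k : Fin (m + 1)) (r : D.Region), D.white r = true →
      (D.twist v m b).cornerDiff (Sum.inr k) 1 (Sum.inl r) = 0 := by
    intro k r hr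
    have n1 : ¬ (D.twist v m b).corner (Sum.inr k) 1 = Sum.inl r := fun e => by
      have := (congrArg (D.twist v m b).white e).symm.trans (D.white_twistRegion_one v m b k)
      exact absurd ((hr.symm.trans this).trans hW) (by simp)
    have n3 : ¬ (D.twist v m b).corner (Sum.inr k) 3 = Sum.inl r := fun e => by
      have := (congrArg (D.twist v m b).white e).symm.trans (D.white_twistRegion_three v m b k)
      exact absurd ((hr.symm.trans this).trans hW) (by simp)
    exact cornerDiff_eq_zero n1 n3
  rw [(D.twist v m b).det_goeritz_eq (J := D.BoundedWhite) (fun j => Sum.inl j.1)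
    (fun i j hij => Subtype.ext (Sum.inl_injective hij))]
  · congr 1
    ext i j
    refine (Fintype.sum_sum_type _).trans (congrArg₂ _ ?_ ?_)
    · refine Finset.sum_congr rfl fun x _ => ?_
      rw [hold, hold, hold, hold]
      rfl
    · refine (Finset.sum_congr rfl fun k _ => ?_ : _ = ∑ k : Fin (m + 1),
        (if b = false then 1 else -1) * (D.cornerDiff v 0 i.1 * D.cornerDiff v 0 j.1)).trans ?_
      · rw [hrow, hrow, hrow' k _ i.2.1, zero_mul, add_zero, eta_twist_row, h]
        rfl
      · rw [Finset.sum_const, Finset.card_univ, Fintype.card_fin, nsmul_eq_mul,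
          Matrix.smul_apply,
          vecMulVec_apply, smul_eq_mul, twistVector, twistVector]
        push_cast
        ring
  · rintro (r | j)
    · constructor
      · rintro ⟨hr, hrb⟩
        exact ⟨⟨r, hr, fun e => hrb (congrArg Sum.inl e)⟩, rfl⟩
      · rintro ⟨j, hj⟩
        obtain rfl : j.1 = r := Sum.inl_injective hj
        exact ⟨j.2.1, fun e => j.2.2 (Sum.inl_injective e)⟩
    · constructor
      · rintro ⟨hr, -⟩
        exact absurd (hr.symm.trans hW) (by simp)
      · rintro ⟨j, hj⟩
        exact absurd hj (by simp)

theorem det_goeritz_nMove (h : D.white (D.corner v 0) = true) (n : ℤ) :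
    (D.nMove v n).goeritz.det = (D.outerMatrix v + n •
      vecMulVec (D.twistVector v) (D.twistVector v)).det := by
  rcases n with (_ | m) | m
  · have e := D.det_goeritz_smooth_zero v h
    change (D.smooth v 0).goeritz.det = (_ + (0 : ℤ) • _ : Matrix _ _ ℤ).det
    rw [e, zero_smul, add_zero]
  · have e := D.det_goeritz_twist v h m false
    rw [if_pos rfl, mul_one] at e
    exact e
  · have e := D.det_goeritz_twist v h m true
    rw [if_neg (by simp), mul_neg_one] at e
    exact e

/-- The determinant of the diagram in which the northern and the southern regions are merged, in
terms of any bounded region `p` among them. -/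
theorem det_goeritz_smooth_one (p : D.BoundedWhite) (t : D.BoundedWhite → ℤ)
    (hp : ∀ r, (r ∈ Set.range (D.smoothMerge v 1) ∧ D.white r = true ∧
      r ≠ D.smoothMerge v 1 D.base) ↔ ∃ j : {j : D.BoundedWhite // j ≠ p}, j.1.1 = r)
    (ht : ∀ (j : {j : D.BoundedWhite // j ≠ p}) c,
      (if D.smoothMerge v 1 c = j.1.1 then 1 else 0) =
        (if c = j.1.1 then 1 else 0) + t j.1 * if c = p.1 then 1 else 0) :
    (D.smooth v 1).goeritz.det = (of fun i j : {j // j ≠ p} => D.outerMatrix v i j +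
      t i * D.outerMatrix v p j + t j * D.outerMatrix v i p +
        t i * t j * D.outerMatrix v p p).det := by
  rw [(D.smooth v 1).det_goeritz_eq (J := {j : D.BoundedWhite // j ≠ p})
    (fun j => ⟨j.1.1, ((hp _).mpr ⟨j, rfl⟩).1⟩)
    (fun i j hij => by
      have := congrArg Subtype.val hij
      exact Subtype.ext (Subtype.ext this))]
  · congr 1
    ext i j
    -- By `ht`, merging adds `t j` times the indicator of `p` to that of `j`. In the matrix this
    -- adds multiples of the row and the column of `p` to the others.
    have hd : ∀ (x : D.Crossing) k (j : {j : D.BoundedWhite // j ≠ p}),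
        D.mergedDiff v 1 x k j.1.1 =
          D.cornerDiff x k j.1.1 + t j.1 * D.cornerDiff x k p.1 := by
      intro x k j
      rw [mergedDiff, ht, ht, cornerDiff, cornerDiff]
      ring
    simp only [of_apply, outerMatrix, Finset.mul_sum, ← Finset.sum_add_distrib]
    refine Finset.sum_congr rfl fun x _ => ?_
    refine (D.smooth_summand v 1 x _ _).trans ?_
    rw [hd, hd, hd, hd]
    ring
  · intro r
    constructor
    · rintro ⟨hr, hrb⟩
      obtain ⟨j, hj⟩ := (hp r.1).mp ⟨r.2, hr, fun e => hrb (Subtype.ext e)⟩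
      exact ⟨j, Subtype.ext hj⟩
    · rintro ⟨j, rfl⟩
      have := (hp _).mpr ⟨j, rfl⟩
      exact ⟨this.2.1, fun e => this.2.2 (congrArg Subtype.val e)⟩

/-- The rank one term is the square of the difference of the indicators of the northern and southern
regions. The index `p` is the one lost under the merging, and `t` records the bounded region, if
any, that absorbs it. -/
theorem det_nMove_sub (h : D.white (D.corner v 0) = true) (hne : D.corner v 0 ≠ D.corner v 2)
    (n : ℤ) : (D.nMove v n).goeritz.det - (D.nMove v 0).goeritz.det =
      n * (D.infinityMove v).goeritz.det := by
  have hS : D.white (D.corner v 2) = true := by rw [white_corner_two, h]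
  have hmerge : ∀ r, D.smoothMerge v 1 r = if r = D.corner v 0 then D.corner v 2 else r :=
    fun _ => rfl
  have hu : ∀ j, D.twistVector v j = (if D.corner v 0 = j.1 then 1 else 0) -
      if D.corner v 2 = j.1 then 1 else 0 := fun _ => rfl
  rw [infinityMove, det_goeritz_nMove D v h, det_goeritz_nMove D v h, zero_smul, add_zero]
  by_cases hb : D.base = D.corner v 0
  -- The northern region is unbounded. The southern one becomes part of the unbounded region, so its
  -- row and column are simply deleted and `t = 0`.
  · have hSb : D.corner v 2 ≠ D.base := fun e => hne (hb.symm.trans e.symm)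
    rw [D.det_goeritz_smooth_one v ⟨D.corner v 2, hS, hSb⟩ 0,
      det_add_smul_vecMulVec_self _ _ 0 ⟨D.corner v 2, hS, hSb⟩ rfl]
    · ring
    · rintro ⟨j, hj, hjb⟩ hjp
      have h2 : j ≠ D.corner v 2 := fun e => hjp (Subtype.ext e)
      have h0 : j ≠ D.corner v 0 := fun e => hjb (e.trans hb.symm)
      simp [hu, h2.symm, h0.symm]
    · simp [hu, hne]
    · intro r
      simp only [Set.mem_range, hmerge]
      rw [if_pos hb]
      constructor
      · rintro ⟨⟨y, hy⟩, hr, hrS⟩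
        have hrN : r ≠ D.corner v 0 := by grind
        exact ⟨⟨⟨r, hr, fun e => hrN (e.trans hb)⟩, fun e => hrS (congrArg Subtype.val e)⟩, rfl⟩
      · rintro ⟨⟨⟨r, hr, hrb⟩, hrp⟩, rfl⟩
        exact ⟨⟨r, if_neg fun e => hrb (e.trans hb.symm)⟩, hr, fun e => hrp (Subtype.ext e)⟩
    · rintro ⟨⟨j, hj, hjb⟩, hjp⟩ c
      have h2 : j ≠ D.corner v 2 := fun e => hjp (Subtype.ext e)
      have h0 : j ≠ D.corner v 0 := fun e => hjb (e.trans hb.symm)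
      simp only [hmerge]
      simp only [Pi.zero_apply, zero_mul, add_zero]
      grind
  -- The northern region is bounded and is absorbed by the southern one. If the latter is unbounded,
  -- its indicator `t` is zero on the bounded regions, as it should be.
  · have hNb : D.corner v 0 ≠ D.base := fun e => hb e.symm
    rw [D.det_goeritz_smooth_one v ⟨D.corner v 0, h, hNb⟩
        (fun j => if D.corner v 2 = j.1 then 1 else 0),
      det_add_smul_vecMulVec_self _ _ (fun j => if D.corner v 2 = j.1 then 1 else 0)
        ⟨D.corner v 0, h, hNb⟩ (if_neg hne.symm)]
    · ring
    · rintro ⟨j, hj, hjb⟩ hjp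
      have h0 : j ≠ D.corner v 0 := fun e => hjp (Subtype.ext e)
      simp [hu, h0.symm, hne.symm]
    · simp [hu, hne.symm]
    · intro r
      simp only [Set.mem_range, hmerge]
      rw [if_neg hb]
      constructor
      · rintro ⟨⟨y, hy⟩, hr, hrb⟩
        have hrN : r ≠ D.corner v 0 := by grind
        exact ⟨⟨⟨r, hr, hrb⟩, fun e => hrN (congrArg Subtype.val e)⟩, rfl⟩
      · rintro ⟨⟨⟨r, hr, hrb⟩, hrp⟩, rfl⟩
        exact ⟨⟨r, if_neg fun e => hrp (Subtype.ext e)⟩, hr, hrb⟩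
    · rintro ⟨⟨j, hj, hjb⟩, hjp⟩ c
      have h0 : j ≠ D.corner v 0 := fun e => hjp (Subtype.ext e)
      simp only [hmerge]
      grind

end LinkDiagram

theorem corollary2p13 (D : LinkDiagram) (v : D.Crossing) :
    (D.white (D.corner v 0) = true →
      (D.corner v 0 ≠ D.corner v 2 → ∀ n : ℤ,
        (D.nMove v n).goeritz.det - (D.nMove v 0).goeritz.det =
          n * (D.infinityMove v).goeritz.det) ∧
      (∀ n : ℤ, 0 ≤ n →
        (D.nMove v 0).goeritzSignature ≤ (D.nMove v n).goeritzSignature ∧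
        (D.nMove v n).goeritzSignature ≤ (D.nMove v 0).goeritzSignature + 2) ∧
      (∀ n : ℤ,
        |(D.nMove v n).goeritzSignature - (D.infinityMove v).goeritzSignature| ≤ 1 ∧
        ((D.nMove v n).goeritzSignature = (D.infinityMove v).goeritzSignature ↔
          ((D.nMove v n).goeritzRank = (D.infinityMove v).goeritzRank ∨
            (D.nMove v n).goeritzRank = (D.infinityMove v).goeritzRank + 2)))) ∧
    (∀ n : ℤ, 0 ≤ n →
      ∀ (o : LinkDiagram.Orientation (D.nMove v 0)) (o' : LinkDiagram.Orientation (D.nMove v n)),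
        D.AgreeOutside v o o' → D.IsParallel v o →
          n - 2 ≤ o.signature - o'.signature ∧ o.signature - o'.signature ≤ n) ∧
    (∀ k : ℤ, 0 ≤ k →
      ∀ (o : LinkDiagram.Orientation (D.nMove v 0))
        (o' : LinkDiagram.Orientation (D.nMove v (2 * k))),
        D.AgreeOutside v o o' → ¬ D.IsParallel v o →
          0 ≤ o'.signature - o.signature ∧ o'.signature - o.signature ≤ 2) ∧
    (∀ o : LinkDiagram.Orientation D, o.IsPositive v →
      0 ≤ (o.crossingChange v).signature - o.signature ∧
      (o.crossingChange v).signature - o.signature ≤ 2) := by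
  refine ⟨fun h => ⟨fun hne n => D.det_nMove_sub v h hne n,
    fun n hn => D.nMove_goeritzSignature_bounds v h hn,
    fun n => D.nMove_infinityMove_signature v h n⟩,
    fun n hn o o' ho hpar => D.signature_bounds_of_parallel v hn o o' ho hpar,
    fun k hk o o' ho hpar => D.signature_bounds_of_not_parallel v (by omega) o o' ho hpar,
    fun o ho => ho.signature_crossingChange_bounds⟩
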